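/- Let $G$ be a complete graph on a finite vertex set, each of whose edges $e$ is assigned a color $\mathrm{col}(e)$ (colors not necessarily distinct). A path or cycle in $G$ is properly colored (PC) if any two of its adjacent edges have distinct colors. The character of a path $P=u_1u_2\cdots u_m$ with $m\ge 2$ is $ch(P)=[u_1,\mathrm{col}(u_1u_2),\mathrm{col}(u_{m-1}u_m),u_m]$, where $[u,a,b,u']$ and $[u',b,a,u]$ are regarded as the same object. Suppose that $P=u_1u_2\cdots u_m$ ($m\ge 2$) is a PC path and $C$ is a PC cycle of $G$ such that $P$ and $C$ are vertex-disjoint and $V(P)\cup V(C)=V(G)$. Let $ch(P)=[u_1,x,y,u_m]$, and suppose that every edge between $u_1$ and $V(C)$ has color $x$ and every edge between $u_m$ and $V(C)$ has color $y$. Then $G$ contains a PC Hamilton path $Q$ with $ch(Q)=ch(P)$. -/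

import Mathlib

namespace EdgeColored

open SimpleGraph

variable {V K : Type*} {G : SimpleGraph V}

/-- A subgraph of an edge-colored graph is *properly colored* (PC) if any two distinct adjacent
edges `va`, `vb` of the subgraph have distinct colors. -/
def IsPC (c : G.EdgeLabeling K) (H : G.Subgraph) : Prop :=
  ∀ ⦃v a b : V⦄ (ha : H.Adj v a) (hb : H.Adj v b), a ≠ b →
    c.get v a ha.adj_sub ≠ c.get v b hb.adj_sub

/-- `col(v, S)`: the set of colors of the edges between `v` and `S - v`. -/
def colorsTo (c : G.EdgeLabeling K) (v : V) (S : Set V) : Set K :=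
  {k | ∃ w ∈ S, ∃ h : G.Adj v w, c.get v w h = k}

/-- The character `[u₁, col(u₁u₂), col(uₘ₋₁uₘ), uₘ]` of a path `u₁u₂⋯uₘ` with `m ≥ 2`. It does not
change when the path is reversed, so it is the unordered pair of `(u₁, col(u₁u₂))` and
`(uₘ, col(uₘ₋₁uₘ))`. -/
def character (c : G.EdgeLabeling K) {u v : V} (P : G.Walk u v) (hP : ¬ P.Nil) : Sym2 (V × K) :=
  s((u, c.get u P.snd (P.adj_snd hP)), (v, c.get P.penultimate v (P.adj_penultimate hP)))

/-- `{P, C}` is a 1-path-cycle factor of `G`: a path `P` and a cycle `C` that are vertex-disjoint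
and together span `G`. -/
structure IsOnePathCycleFactor {u v w : V} (P : G.Walk u v) (C : G.Walk w w) : Prop where
  isPath : P.IsPath
  isCycle : C.IsCycle
  disjoint : ∀ z, z ∈ P.support → z ∉ C.support
  spanning : ∀ z, z ∈ P.support ∨ z ∈ C.support

end EdgeColored

/-! Fix the cycle length `k` and take a counterexample whose path is as short as possible. Let `v 0,
…, v (n + 1)` be the path with edge colors `q 1, …, q (n + 1)`, and let `e j` be the color of the
cycle edge from `c j` to `c (j + 1)`. A Hamilton path of the same character arises when one path
edge is replaced by a detour through all of the cycle, or two path edges by detours through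
complementary arcs (`Losing.one`, `Losing.two`; `Losing.three` also reverses the middle of the
path). The ends of the path impose no condition of their own, since all their edges to the cycle
have the right color. In a counterexample all these constructions fail, and each failure is an
equation between colors.

If an inner vertex `v i` saw the whole cycle in its forward color `q (i + 1)`, the path from `v i`
on would give a shorter counterexample (`Losing.drop`). So every inner vertex has an edge to the
cycle that is not of its forward color and, by symmetry, one that is not of its backward color. At
`v 1` such an edge is of one of two kinds, `Alpha` and `Beta` (`Minimal.nonF_cases`); likewise at `v
n`.

For `k ≥ 4`, comparing the two ends shows that the end colors differ (`Minimal.ne_of_four_le`) and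
that the special cycle vertices of `v 1` and `v n` are neighbors (`Minimal.beta_beta`). Then three
consecutive cycle vertices span a properly colored triangle and the path can absorb the rest of the
cycle, which reduces to `k = 3` (`Minimal.false_of_adjacent`).

For `k = 3`, each end has one special vertex of the triangle. The two cannot coincide
(`Special.ne_of_rev`). If they differ (`Opposed`), the colors towards the triangle are followed
along the path until their pattern switches, and a chord from `v 1` to a later path vertex completes
a Hamilton path (`Opposed.false`). -/

namespace EdgeColored

/-! ### Properly colored trails and lists of consecutive vertices. -/

variable {V K : Type*}

/-- `Trail col α a l b β`: the list `l` is a properly colored walk from `a` to `b` which stays properly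
colored when an edge of color `α` is attached at its start and one of color `β` at its end. -/
inductive Trail (col : V → V → K) : K → V → List V → V → K → Prop
  | single {α β : K} {a : V} (h : α ≠ β) : Trail col α a [a] a β
  | cons {α β : K} {a b z : V} {l : List V} (h : α ≠ col a b)
      (t : Trail col (col a b) b l z β) : Trail col α a (a :: l) z β

namespace Trail

variable {col : V → V → K} {α β : K} {a b a' b' : V} {l l' : List V}

theorem append (h : Trail col α a l b (col b a')) (h' : Trail col (col b a') a' l' b' β) :
    Trail col α a (l ++ l') b' β := by
  generalize hγ : col b a' = γ at h
  induction h with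
  | single h => subst hγ; exact .cons h h'
  | cons h t ih => exact .cons h (ih h' hγ)

theorem glue {γ : K} (h : Trail col α a l b γ) (h' : Trail col γ a' l' b' β) (hγ : γ = col b a') :
    Trail col α a (l ++ l') b' β := by
  subst hγ; exact h.append h'

theorem reverse (hs : ∀ a b, col a b = col b a) (h : Trail col α a l b β) :
    Trail col β b l.reverse a α := by
  induction h with
  | single h => exact .single h.symm
  | @cons α β a b z l h t ih =>
    rw [List.reverse_cons]
    rw [hs a b] at ih h
    exact ih.append (.single h.symm)

theorem ne_nil (h : Trail col α a l b β) : l ≠ [] := by cases h <;> simp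

end Trail

/-- The list `f 0, f 1, …, f m`. -/
def run (f : ℕ → V) (m : ℕ) : List V := (List.range (m + 1)).map f

theorem run_zero (f : ℕ → V) : run f 0 = [f 0] := rfl

theorem run_succ (f : ℕ → V) (m : ℕ) : run f (m + 1) = run f m ++ [f (m + 1)] := by
  simp [run, List.range_succ (n := m + 1)]

theorem run_succ' (f : ℕ → V) (m : ℕ) : run f (m + 1) = f 0 :: run (fun t => f (t + 1)) m := by
  simp [run, List.range_succ_eq_map (n := m + 1), Function.comp_def]

theorem run_append (f : ℕ → V) (m l : ℕ) :
    run f m ++ run (fun t => f (m + 1 + t)) l = run f (m + 1 + l) := by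
  induction l with
  | zero => simp [run_zero, run_succ]
  | succ l ih => rw [run_succ, ← List.append_assoc, ih, ← add_assoc, run_succ]

theorem mem_run {f : ℕ → V} {m : ℕ} {a : V} : a ∈ run f m ↔ ∃ t ≤ m, f t = a := by
  simp [run]

theorem length_run (f : ℕ → V) (m : ℕ) : (run f m).length = m + 1 := by simp [run]

theorem Trail.run {col : V → V → K} {f : ℕ → V} {m : ℕ} {α β : K}
    (hf : ∀ t, t + 2 ≤ m → col (f t) (f (t + 1)) ≠ col (f (t + 1)) (f (t + 2)))
    (h0 : m = 0 → α ≠ β) (h1 : 0 < m → α ≠ col (f 0) (f 1))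
    (h2 : 0 < m → col (f (m - 1)) (f m) ≠ β) :
    Trail col α (f 0) (run f m) (f m) β := by
  induction m generalizing f α with
  | zero => exact .single (h0 rfl)
  | succ m ih =>
    rw [run_succ']
    refine .cons (b := f 1) (h1 (by omega)) ?_
    refine ih (f := fun t => f (t + 1)) (fun t ht => hf (t + 1) (by omega)) ?_ ?_ ?_
    · intro hm; subst hm; exact h2 (by omega)
    · intro hm; exact hf 0 (by omega)
    · intro hm
      have := h2 (by omega)
      obtain ⟨m, rfl⟩ : ∃ l, m = l + 1 := ⟨m - 1, by omega⟩
      simpa using this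

/-- `HamPath col S u w x y`: the elements of the list `S` can be arranged into a properly colored
path from `u` to `w` whose first edge has color `x` and whose last edge has color `y`. -/
def HamPath (col : V → V → K) (S : List V) (u w : V) (x y : K) : Prop :=
  ∃ L : List V, L.Perm S ∧ ∀ ξ η, ξ ≠ x → η ≠ y → Trail col ξ u L w η

theorem HamPath.reverse {col : V → V → K} (hs : ∀ a b, col a b = col b a) {S : List V} {u w : V}
    {x y : K} (h : HamPath col S u w x y) : HamPath col S w u y x := by
  obtain ⟨L, hL, h⟩ := h
  exact ⟨L.reverse, (List.reverse_perm L).trans hL, fun ξ η hξ hη => (h η ξ hη hξ).reverse hs⟩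

/-- The vertices `c s, c (s + 1), …, c (s + m)`. -/
def arc (c : ℤ → V) (s : ℤ) (m : ℕ) : List V := run (fun t : ℕ => c (s + t)) m

/-- The vertices `v i, v (i + 1), …, v (i + m)`. -/
def seg (v : ℕ → V) (i m : ℕ) : List V := run (fun t : ℕ => v (i + t)) m

theorem seg_append (v : ℕ → V) (i m j l : ℕ) (h : j = i + m + 1) :
    seg v i m ++ seg v j l = seg v i (m + 1 + l) := by
  subst h
  rw [seg, seg, seg, ← run_append]
  simp only [add_assoc, add_comm, add_left_comm]

theorem arc_append (c : ℤ → V) (s t : ℤ) (m l : ℕ) (h : t = s + m + 1) :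
    arc c s m ++ arc c t l = arc c s (m + 1 + l) := by
  subst h
  rw [arc, arc, arc, ← run_append]
  push_cast
  simp only [add_assoc]

end EdgeColored

namespace EdgeColored

/-! ### Configurations of a path and a cycle, and their symmetries. -/

variable {V K : Type*}

/-- A path `v 0, …, v (n + 1)` with edge colors `q 1, …, q (n + 1)`, together with a cycle
`c 0, …, c (k - 1)` (extended periodically) in a complete graph with edge coloring `col`. -/
structure Config (V K : Type*) where
  col : V → V → K
  n : ℕ
  k : ℕ
  v : ℕ → V
  q : ℕ → K
  c : ℤ → V

namespace Config

variable (X : Config V K)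

/-- The color of the edge from `v i` to `c j`. -/
def r (i : ℕ) (j : ℤ) : K := X.col (X.v i) (X.c j)

/-- The color of the cycle edge from `c j` to `c (j + 1)`. -/
def e (j : ℤ) : K := X.col (X.c j) (X.c (j + 1))

/-- The vertices `c s, …, c t`. -/
def iv (s t : ℤ) : List V := arc X.c s (t - s).toNat

/-- All vertices of the configuration. -/
def verts : List V := seg X.v 0 (X.n + 1) ++ arc X.c 0 (X.k - 1)

/-- The path and the cycle are properly colored and disjoint, and all edges between an end of the
path and the cycle have the color of the path edge at that end. -/
structure Valid : Prop where
  symm : ∀ a b, X.col a b = X.col b a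
  three_le : 3 ≤ X.k
  injv : ∀ i j, i ≤ X.n + 1 → j ≤ X.n + 1 → X.v i = X.v j → i = j
  perc : ∀ i, X.c (i + X.k) = X.c i
  injc : ∀ i j, X.c i = X.c j → (X.k : ℤ) ∣ i - j
  disj : ∀ i j, i ≤ X.n + 1 → X.v i ≠ X.c j
  hq : ∀ i, i ≤ X.n → X.q (i + 1) = X.col (X.v i) (X.v (i + 1))
  qne : ∀ i, 1 ≤ i → i ≤ X.n → X.q i ≠ X.q (i + 1)
  ene : ∀ i, X.e i ≠ X.e (i + 1)
  left : ∀ j, X.r 0 j = X.q 1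
  right : ∀ j, X.r (X.n + 1) j = X.q (X.n + 1)

/-- The configuration has a properly colored Hamilton path with the character of its path. -/
def Win : Prop := HamPath X.col X.verts (X.v 0) (X.v (X.n + 1)) (X.q 1) (X.q (X.n + 1))

/-- A valid configuration which contradicts the theorem. -/
structure Losing : Prop extends X.Valid where
  no : ¬ X.Win

/-- Renumber the cycle. -/
def shift (s : ℤ) : Config V K := { X with c := fun j => X.c (j + s) }

/-- Reverse the cycle. -/
def refl : Config V K := { X with c := fun j => X.c (-j) }

/-- Reverse the path. -/
def rev : Config V K :=
  { X with v := fun i => X.v (X.n + 1 - i), q := fun i => X.q (X.n + 2 - i) }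

@[simp] theorem shift_n (s) : (X.shift s).n = X.n := rfl
@[simp] theorem shift_k (s) : (X.shift s).k = X.k := rfl
@[simp] theorem shift_q (s i) : (X.shift s).q i = X.q i := rfl
@[simp] theorem shift_r (s i j) : (X.shift s).r i j = X.r i (j + s) := rfl
@[simp] theorem shift_e (s j) : (X.shift s).e j = X.e (j + s) := by
  simp [e, shift, add_right_comm]
@[simp] theorem refl_n : X.refl.n = X.n := rfl
@[simp] theorem refl_k : X.refl.k = X.k := rfl
@[simp] theorem refl_q (i) : X.refl.q i = X.q i := rfl
@[simp] theorem refl_r (i j) : X.refl.r i j = X.r i (-j) := rfl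
@[simp] theorem rev_n : X.rev.n = X.n := rfl
@[simp] theorem rev_k : X.rev.k = X.k := rfl
@[simp] theorem rev_e (j) : X.rev.e j = X.e j := rfl
@[simp] theorem rev_q (i) : X.rev.q i = X.q (X.n + 2 - i) := rfl
@[simp] theorem rev_r (i j) : X.rev.r i j = X.r (X.n + 1 - i) j := rfl

variable {X}

theorem arc_mem_iff (h : X.Valid) (s : ℤ) (a : V) : a ∈ arc X.c s (X.k - 1) ↔ ∃ j, X.c j = a := by
  have hk := h.three_le
  rw [arc, mem_run]
  constructor
  · rintro ⟨t, -, rfl⟩; exact ⟨_, rfl⟩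
  · rintro ⟨j, rfl⟩
    have hper : Function.Periodic X.c (X.k : ℤ) := h.perc
    have h0 := Int.emod_nonneg (j - s) (show (X.k : ℤ) ≠ 0 by omega)
    have h1 := Int.emod_lt_of_pos (j - s) (show (0 : ℤ) < X.k by omega)
    refine ⟨((j - s) % X.k).toNat, by omega, ?_⟩
    rw [Int.toNat_of_nonneg h0, Int.emod_def]
    have := hper.sub_int_mul_eq ((j - s) / X.k) (x := j)
    rw [← this]
    congr 1
    push_cast
    ring

theorem nodup_arc (h : X.Valid) (s : ℤ) {m : ℕ} (hm : m < X.k) : (arc X.c s m).Nodup := by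
  rw [arc, run]
  refine List.Nodup.map_on ?_ List.nodup_range
  intro x hx y hy hxy
  have := h.injc _ _ hxy
  simp at hx hy
  obtain ⟨z, hz⟩ := this
  have : z = 0 := by nlinarith [Int.lt_irrefl 0, sq_nonneg z, show (0:ℤ) < X.k by omega, (show z < 1 by by_contra hh; nlinarith), (show -1 < z by by_contra hh; nlinarith)]
  subst this
  omega

theorem arc_perm (h : X.Valid) (s s' : ℤ) :
    (arc X.c s (X.k - 1)).Perm (arc X.c s' (X.k - 1)) := by
  have hk := h.three_le
  rw [List.perm_ext_iff_of_nodup (nodup_arc h s (by omega)) (nodup_arc h s' (by omega))]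
  intro a
  rw [arc_mem_iff h, arc_mem_iff h]

theorem iv_perm (h : X.Valid) {s t : ℤ} (hst : s ≤ t) (ht : t ≤ s + X.k - 2) :
    (X.iv s t ++ X.iv (t + 1) (s + X.k - 1)).Perm (arc X.c 0 (X.k - 1)) := by
  rw [iv, iv, arc_append _ _ _ _ _ (by omega)]
  have : (t - s).toNat + 1 + (s + X.k - 1 - (t + 1)).toNat = X.k - 1 := by omega
  rw [this]
  exact arc_perm h _ _

theorem perr (h : X.Valid) (i : ℕ) (j : ℤ) : X.r i (j + X.k) = X.r i j := by
  simp [r, h.perc]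

theorem pere (h : X.Valid) (j : ℤ) : X.e (j + X.k) = X.e j := by
  rw [e, e, h.perc, ← h.perc (j + 1), add_right_comm]

theorem perr_mul (h : X.Valid) (i : ℕ) (j z : ℤ) : X.r i (j + z * X.k) = X.r i j :=
  Function.Periodic.int_mul (f := X.r i) (perr h i) z j

theorem pere_mul (h : X.Valid) (j z : ℤ) : X.e (j + z * X.k) = X.e j :=
  Function.Periodic.int_mul (f := X.e) (pere h) z j

theorem refl_e (h : X.Valid) (j) : X.refl.e j = X.e (-j - 1) := by
  simp only [e, refl]
  rw [h.symm]
  congr 2 <;> ring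

theorem Valid.shift (h : X.Valid) (s : ℤ) : (X.shift s).Valid where
  symm := h.symm
  three_le := h.three_le
  injv := h.injv
  perc i := by
    have := h.perc (i + s)
    simp only [Config.shift]
    rw [← this]; congr 1; ring
  injc i j hij := by
    have := h.injc _ _ hij
    simpa using this
  disj i j hi := h.disj i _ hi
  hq := h.hq
  qne := h.qne
  ene i := by
    rw [shift_e, shift_e, add_right_comm]; exact h.ene _
  left j := h.left _
  right j := h.right _

theorem Valid.refl (h : X.Valid) : X.refl.Valid where
  symm := h.symm
  three_le := h.three_le
  injv := h.injv
  perc i := by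
    have := h.perc (-(i + X.k))
    simp only [Config.refl]
    rw [← this]; congr 1; ring
  injc i j hij := by
    have := h.injc _ _ hij
    rw [← dvd_neg]
    rwa [show -(i - j) = -i - -j by ring]
  disj i j hi := h.disj i _ hi
  hq := h.hq
  qne := h.qne
  ene i := by
    rw [refl_e h, refl_e h]
    have := h.ene (-(i + 1) - 1)
    rw [show -(i + 1) - 1 + 1 = -i - 1 by ring] at this
    exact this.symm
  left j := h.left _
  right j := h.right _

theorem Valid.rev (h : X.Valid) : X.rev.Valid where
  symm := h.symm
  three_le := h.three_le
  injv i j hi hj hij := by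
    have := h.injv _ _ (by simp) (by simp) hij
    simp at hi hj
    omega
  perc := h.perc
  injc := h.injc
  disj i j hi := h.disj _ _ (by simp)
  hq i hi := by
    simp at hi
    have := h.hq (X.n - i) (by omega)
    simp only [Config.rev]
    rw [h.symm]
    convert this using 2 <;> first | omega | (congr 1; omega)
  qne i h1 hi := by
    simp at hi
    have := h.qne (X.n + 1 - i) (by omega) (by omega)
    simp only [rev_q]
    convert this.symm using 2 <;> omega
  ene := h.ene
  left j := by simpa using h.right j
  right j := by simpa using h.left j

theorem seg_rev (v : ℕ → V) (m : ℕ) : seg (fun i => v (m - i)) 0 m = (seg v 0 m).reverse := by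
  apply List.ext_getElem
  · simp [seg, length_run]
  · intro i h1 h2
    simp [seg, length_run] at h1
    simp [seg, run]

theorem Losing.shift (h : X.Losing) (s : ℤ) : (X.shift s).Losing where
  toValid := h.toValid.shift s
  no := by
    rintro ⟨L, hL, ht⟩
    refine h.no ⟨L, hL.trans ?_, ht⟩
    refine List.Perm.append (List.Perm.refl _) ?_
    have : arc (X.shift s).c 0 ((X.shift s).k - 1) = arc X.c s (X.k - 1) := by
      simp [arc, Config.shift, add_comm]
    rw [this]
    exact arc_perm h.toValid _ _

theorem Losing.refl (h : X.Losing) : X.refl.Losing where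
  toValid := h.toValid.refl
  no := by
    rintro ⟨L, hL, ht⟩
    refine h.no ⟨L, hL.trans ?_, ht⟩
    refine List.Perm.append (List.Perm.refl _) ?_
    have hk := h.three_le
    rw [List.perm_ext_iff_of_nodup]
    · intro a
      rw [arc_mem_iff h.toValid, arc_mem_iff h.toValid.refl]
      constructor
      · rintro ⟨j, rfl⟩; exact ⟨-j, rfl⟩
      · rintro ⟨j, rfl⟩; exact ⟨-j, by simp [Config.refl]⟩
    · exact nodup_arc h.toValid.refl _ (by simp; omega)
    · exact nodup_arc h.toValid _ (by omega)

theorem Losing.rev (h : X.Losing) : X.rev.Losing where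
  toValid := h.toValid.rev
  no := by
    rintro ⟨L, hL, ht⟩
    refine h.no ?_
    have := HamPath.reverse (h.symm) ⟨L, hL, ht⟩
    simp only [rev_n, rev_q] at this
    obtain ⟨L, hL, ht⟩ := this
    refine ⟨L, hL.trans ?_, ?_⟩
    · refine List.Perm.append ?_ (List.Perm.refl _)
      exact (seg_rev X.v (X.n + 1) ▸ List.reverse_perm _ :)
    · simpa [Config.rev] using ht

/-! ### Trails along the path and the cycle -/

theorem trail_seg (h : X.Valid) {i j : ℕ} (hij : i ≤ j) (hj : j ≤ X.n + 1) {α β : K}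
    (h0 : i = j → α ≠ β) (h1 : i < j → α ≠ X.q (i + 1)) (h2 : i < j → X.q j ≠ β) :
    Trail X.col α (X.v i) (seg X.v i (j - i)) (X.v j) β := by
  obtain ⟨m, rfl⟩ := Nat.exists_eq_add_of_le hij
  rw [Nat.add_sub_cancel_left]
  refine Trail.run (f := fun t => X.v (i + t)) ?_ ?_ ?_ ?_
  · intro t ht
    have := h.qne (i + t + 1) (by omega) (by omega)
    rw [h.hq _ (by omega), h.hq _ (by omega)] at this
    simpa [add_assoc] using this
  · intro hm; exact h0 (by omega)
  · intro hm
    have := h1 (by omega)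
    rwa [h.hq _ (by omega)] at this
  · intro hm
    obtain ⟨m, rfl⟩ : ∃ l, m = l + 1 := ⟨m - 1, by omega⟩
    have := h2 (by omega)
    rw [← add_assoc, h.hq _ (by omega)] at this
    simpa [add_assoc] using this

theorem trail_asc (h : X.Valid) {s t : ℤ} (hst : s ≤ t) {α β : K}
    (h0 : s = t → α ≠ β) (h1 : s < t → α ≠ X.e s) (h2 : s < t → X.e (t - 1) ≠ β) :
    Trail X.col α (X.c s) (X.iv s t) (X.c t) β := by
  obtain ⟨m, rfl⟩ := Int.exists_add_of_le hst
  rw [iv, add_sub_cancel_left, Int.toNat_natCast]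
  have := Trail.run (f := fun t : ℕ => X.c (s + t)) (col := X.col) (m := m) (α := α) (β := β)
    ?_ ?_ ?_ ?_
  · simpa [arc] using this
  · intro t ht
    have := h.ene (s + t)
    simp only [e] at this
    push_cast
    simpa [add_assoc] using this
  · intro hm; exact h0 (by omega)
  · intro hm; simpa [e] using h1 (by omega)
  · intro hm
    obtain ⟨m, rfl⟩ : ∃ l, m = l + 1 := ⟨m - 1, by omega⟩
    have := h2 (by omega)
    have e1 : s + ((m + 1 : ℕ) : ℤ) - 1 = s + m := by push_cast; ring
    rw [e1, e, add_assoc] at this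
    simpa using this

theorem trail_desc (h : X.Valid) {s t : ℤ} (hst : s ≤ t) {α β : K}
    (h0 : s = t → α ≠ β) (h1 : s < t → α ≠ X.e (t - 1)) (h2 : s < t → X.e s ≠ β) :
    Trail X.col α (X.c t) (X.iv s t).reverse (X.c s) β :=
  (trail_asc h hst (fun a => (h0 a).symm) (fun a => (h2 a).symm) (fun a => (h1 a).symm)).reverse h.symm

theorem perm_insert {S₁ S₂ S₃ A B P R : List V} (hp : (A ++ B).Perm R) (hP : S₁ ++ S₂ ++ S₃ = P) :
    (S₁ ++ (A ++ (S₂ ++ (B ++ S₃)))).Perm (P ++ R) := by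
  classical
  subst hP
  rw [List.perm_iff_count] at hp ⊢
  intro a
  have := hp a
  simp only [List.count_append] at this ⊢
  omega

theorem path_split {i j : ℕ} (hij : i < j) (hj : j ≤ X.n) :
    seg X.v 0 i ++ seg X.v (i + 1) (j - (i + 1)) ++ seg X.v (j + 1) (X.n - j) =
      seg X.v 0 (X.n + 1) := by
  rw [seg_append _ _ _ _ _ (by omega), seg_append _ _ _ _ _ (by omega)]
  congr 1
  omega

/-- The path edge from `v i` to `v (i + 1)` is replaced by `A`. Nothing is asked at an end of the
path, because there `left` and `right` give the detour the color of the removed edge. -/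
theorem Losing.one (h : X.Losing) {i : ℕ} (hi : i ≤ X.n) {a a' : ℤ} {A : List V}
    (h1 : 1 ≤ i → X.r i a ≠ X.q i)
    (hA : Trail X.col (X.r i a) (X.c a) A (X.c a') (X.r (i + 1) a'))
    (h2 : i + 1 ≤ X.n → X.r (i + 1) a' ≠ X.q (i + 2))
    (hp : A.Perm (arc X.c 0 (X.k - 1))) : False := by
  have hv := h.toValid
  refine h.no ⟨seg X.v 0 i ++ (A ++ seg X.v (i + 1) (X.n - i)), ?_, fun ξ η hξ hη => ?_⟩
  · simpa [verts] using perm_insert (B := []) (S₃ := []) (by simpa using hp) (by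
      rw [List.append_nil, seg_append _ _ _ _ _ (by omega)]; congr 1; omega)
  · have t1 := trail_seg hv (i := 0) (j := i) (by omega) (by omega) (α := ξ) (β := X.r i a)
      (by rintro rfl; rw [hv.left]; exact hξ) (fun _ => hξ) (fun hh => (h1 hh).symm)
    have t2 := trail_seg hv (i := i + 1) (j := X.n + 1) (by omega) (by omega) (α := X.r (i + 1) a')
      (β := η) (fun hh => by rw [hh, hv.right]; exact hη.symm) (fun hh => h2 (by omega))
      (fun _ => hη.symm)
    have := t1.append (hA.glue t2 (hv.symm _ _))
    rwa [show X.n + 1 - (i + 1) = X.n - i by omega, Nat.sub_zero] at this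

/-- The new path is `v 0 … v i`, `A`, `v (i + 1) … v j`, `B`, `v (j + 1) … v (n + 1)`. For `j = i +
1` the middle piece is one vertex, whence the separate condition `hm`. -/
theorem Losing.two (h : X.Losing) {i j : ℕ} (hij : i < j) (hj : j ≤ X.n) {a a' b b' : ℤ}
    {A B : List V} (h1 : 1 ≤ i → X.r i a ≠ X.q i)
    (hA : Trail X.col (X.r i a) (X.c a) A (X.c a') (X.r (i + 1) a'))
    (hm : j = i + 1 → X.r j a' ≠ X.r j b) (hm1 : i + 1 < j → X.r (i + 1) a' ≠ X.q (i + 2))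
    (hm2 : i + 1 < j → X.r j b ≠ X.q j)
    (hB : Trail X.col (X.r j b) (X.c b) B (X.c b') (X.r (j + 1) b'))
    (h2 : j + 1 ≤ X.n → X.r (j + 1) b' ≠ X.q (j + 2))
    (hp : (A ++ B).Perm (arc X.c 0 (X.k - 1))) : False := by
  have hv := h.toValid
  refine h.no ⟨seg X.v 0 i ++ (A ++ (seg X.v (i + 1) (j - (i + 1)) ++ (B ++
    seg X.v (j + 1) (X.n - j)))), ?_, fun ξ η hξ hη => ?_⟩
  · exact perm_insert hp (path_split (by omega) hj)
  · have t1 := trail_seg hv (i := 0) (j := i) (by omega) (by omega) (α := ξ) (β := X.r i a)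
      (by rintro rfl; rw [hv.left]; exact hξ) (fun _ => hξ) (fun hh => (h1 hh).symm)
    have t2 := trail_seg hv (i := i + 1) (j := j) (by omega) (by omega) (α := X.r (i + 1) a')
      (β := X.r j b) (fun hh => by rw [hh]; exact hm hh.symm) (fun hh => hm1 (by omega))
      (fun hh => (hm2 hh).symm)
    have t3 := trail_seg hv (i := j + 1) (j := X.n + 1) (by omega) (by omega) (α := X.r (j + 1) b')
      (β := η) (fun hh => by rw [hh, hv.right]; exact hη.symm) (fun hh => h2 (by omega))
      (fun _ => hη.symm)
    have := t1.append (hA.glue (t2.append (hB.glue t3 (hv.symm _ _))) (hv.symm _ _))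
    rwa [show X.n + 1 - (j + 1) = X.n - j by omega, Nat.sub_zero] at this

/-- As in `Losing.two`, but the middle piece is traversed from `v j` back to `v (i + 1)`. -/
theorem Losing.three (h : X.Losing) {i j : ℕ} (hij : i + 1 < j) (hj : j ≤ X.n) {a a' b b' : ℤ}
    {A B : List V} (h1 : 1 ≤ i → X.r i a ≠ X.q i)
    (hA : Trail X.col (X.r i a) (X.c a) A (X.c a') (X.r j a'))
    (hm1 : X.r j a' ≠ X.q j) (hm2 : X.r (i + 1) b ≠ X.q (i + 2))
    (hB : Trail X.col (X.r (i + 1) b) (X.c b) B (X.c b') (X.r (j + 1) b'))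
    (h2 : j + 1 ≤ X.n → X.r (j + 1) b' ≠ X.q (j + 2))
    (hp : (A ++ B).Perm (arc X.c 0 (X.k - 1))) : False := by
  have hv := h.toValid
  refine h.no ⟨seg X.v 0 i ++ (A ++ ((seg X.v (i + 1) (j - (i + 1))).reverse ++ (B ++
    seg X.v (j + 1) (X.n - j)))), ?_, fun ξ η hξ hη => ?_⟩
  · exact (((List.Perm.refl _).append ((List.Perm.refl _).append
      ((List.reverse_perm _).append (List.Perm.refl _)))).trans
      (perm_insert hp (path_split (by omega) hj)))
  · have t1 := trail_seg hv (i := 0) (j := i) (by omega) (by omega) (α := ξ) (β := X.r i a)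
      (by rintro rfl; rw [hv.left]; exact hξ) (fun _ => hξ) (fun hh => (h1 hh).symm)
    have t2 := (trail_seg hv (i := i + 1) (j := j) (by omega) (by omega) (β := X.r j a')
      (α := X.r (i + 1) b) (by omega) (fun _ => hm2) (fun _ => hm1.symm)).reverse hv.symm
    have t3 := trail_seg hv (i := j + 1) (j := X.n + 1) (by omega) (by omega) (α := X.r (j + 1) b')
      (β := η) (fun hh => by rw [hh, hv.right]; exact hη.symm) (fun hh => h2 (by omega))
      (fun _ => hη.symm)
    have := t1.append (hA.glue (t2.append (hB.glue t3 (hv.symm _ _))) (hv.symm _ _))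
    rwa [show X.n + 1 - (j + 1) = X.n - j by omega, Nat.sub_zero] at this

/-! ### Hamilton paths assembled from arcs of the cycle -/

theorem Losing.one_asc (h : X.Losing) (i : ℕ) (hi : i ≤ X.n) (s : ℤ)
    (h1 : 1 ≤ i → X.r i s ≠ X.q i) (h2 : i + 1 ≤ X.n → X.r (i + 1) (s - 1) ≠ X.q (i + 2))
    (h3 : X.r i s ≠ X.e s) (h4 : X.e (s - 2) ≠ X.r (i + 1) (s - 1)) : False := by
  have hv := h.toValid
  have hk := h.three_le
  -- The arc runs from `c s` up to `c (s + k - 1)`, which is `c (s - 1)` one period later.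
  rw [← perr hv] at h2 h4
  rw [← pere hv] at h4
  rw [show s - 1 + X.k = s + X.k - 1 by ring] at h2 h4
  rw [show s - 2 + X.k = s + X.k - 1 - 1 by ring] at h4
  refine h.one hi h1 (trail_asc hv (by omega) (by omega) (fun _ => h3) (fun _ => h4)) h2 ?_
  rw [iv, show (s + X.k - 1 - s).toNat = X.k - 1 by omega]
  exact arc_perm hv _ _

theorem Losing.one_desc (h : X.Losing) (i : ℕ) (hi : i ≤ X.n) (s : ℤ)
    (h1 : 1 ≤ i → X.r i s ≠ X.q i) (h2 : i + 1 ≤ X.n → X.r (i + 1) (s + 1) ≠ X.q (i + 2))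
    (h3 : X.r i s ≠ X.e (s - 1)) (h4 : X.e (s + 1) ≠ X.r (i + 1) (s + 1)) : False := by
  have e1 : -(-s - 1) = s + 1 := by ring
  have e2 : -(-s - 2) - 1 = s + 1 := by ring
  refine h.refl.one_asc i hi (-s) ?_ ?_ ?_ ?_ <;>
    simp only [refl_e h.toValid, refl_r, refl_q, refl_n, e1, e2, neg_neg] <;> assumption

/-- The arc from `c s` to `c t` serves as `A`, its complement as `B`; `c (s - 1)` stands for the
last vertex `c (s + k - 1)` of the complement. `hA0` and `hB0` treat arcs of one vertex. The three
variants below differ in the directions of the arcs. -/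
theorem Losing.two_asc_asc (h : X.Losing) (i j : ℕ) (hij : i < j) (hj : j ≤ X.n) (s t : ℤ)
    (hst : s ≤ t) (hts : t ≤ s + X.k - 2)
    (h1 : 1 ≤ i → X.r i s ≠ X.q i)
    (hA0 : s = t → X.r i s ≠ X.r (i + 1) t) (hA1 : s < t → X.r i s ≠ X.e s)
    (hA2 : s < t → X.e (t - 1) ≠ X.r (i + 1) t)
    (hm : j = i + 1 → X.r j t ≠ X.r j (t + 1)) (hm1 : i + 1 < j → X.r (i + 1) t ≠ X.q (i + 2))
    (hm2 : i + 1 < j → X.r j (t + 1) ≠ X.q j)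
    (hB0 : t = s + X.k - 2 → X.r j (t + 1) ≠ X.r (j + 1) (t + 1))
    (hB1 : t < s + X.k - 2 → X.r j (t + 1) ≠ X.e (t + 1))
    (hB2 : t < s + X.k - 2 → X.e (s - 2) ≠ X.r (j + 1) (s - 1))
    (h2 : j + 1 ≤ X.n → X.r (j + 1) (s - 1) ≠ X.q (j + 2)) : False := by
  have hv := h.toValid
  rw [← perr hv] at h2 hB2
  rw [← pere hv] at hB2
  rw [show s - 1 + X.k = s + X.k - 1 by ring] at h2 hB2
  rw [show s - 2 + X.k = s + X.k - 1 - 1 by ring] at hB2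
  refine h.two hij hj h1 (trail_asc hv hst hA0 hA1 hA2) hm hm1 hm2
    (trail_asc hv (by omega) (fun hh => ?_) (fun hh => hB1 (by omega)) (fun hh => hB2 (by omega)))
    h2 (iv_perm hv hst hts)
  rw [← hh]; exact hB0 (by omega)

theorem Losing.two_asc_desc (h : X.Losing) (i j : ℕ) (hij : i < j) (hj : j ≤ X.n) (s t : ℤ)
    (hst : s ≤ t) (hts : t ≤ s + X.k - 2)
    (h1 : 1 ≤ i → X.r i s ≠ X.q i)
    (hA0 : s = t → X.r i s ≠ X.r (i + 1) t) (hA1 : s < t → X.r i s ≠ X.e s)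
    (hA2 : s < t → X.e (t - 1) ≠ X.r (i + 1) t)
    (hm : j = i + 1 → X.r j t ≠ X.r j (s - 1)) (hm1 : i + 1 < j → X.r (i + 1) t ≠ X.q (i + 2))
    (hm2 : i + 1 < j → X.r j (s - 1) ≠ X.q j)
    (hB0 : t = s + X.k - 2 → X.r j (t + 1) ≠ X.r (j + 1) (t + 1))
    (hB1 : t < s + X.k - 2 → X.r j (s - 1) ≠ X.e (s - 2))
    (hB2 : t < s + X.k - 2 → X.e (t + 1) ≠ X.r (j + 1) (t + 1))
    (h2 : j + 1 ≤ X.n → X.r (j + 1) (t + 1) ≠ X.q (j + 2)) : False := by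
  have hv := h.toValid
  rw [← perr hv _ (s - 1)] at hm hm2 hB1
  rw [← pere hv (s - 2)] at hB1
  rw [show s - 1 + X.k = s + X.k - 1 by ring] at hm hm2 hB1
  rw [show s - 2 + X.k = s + X.k - 1 - 1 by ring] at hB1
  refine h.two hij hj h1 (trail_asc hv hst hA0 hA1 hA2) hm hm1 hm2
    (trail_desc hv (by omega) (fun hh => ?_) (fun hh => hB1 (by omega)) (fun hh => hB2 (by omega)))
    h2 (((List.Perm.refl _).append (List.reverse_perm _)).trans (iv_perm hv hst hts))
  rw [← hh]; exact hB0 (by omega)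

theorem Losing.two_desc_asc (h : X.Losing) (i j : ℕ) (hij : i < j) (hj : j ≤ X.n) (s t : ℤ)
    (hst : s ≤ t) (hts : t ≤ s + X.k - 2)
    (h1 : 1 ≤ i → X.r i t ≠ X.q i)
    (hA0 : s = t → X.r i s ≠ X.r (i + 1) t) (hA1 : s < t → X.r i t ≠ X.e (t - 1))
    (hA2 : s < t → X.e s ≠ X.r (i + 1) s)
    (hm : j = i + 1 → X.r j s ≠ X.r j (t + 1)) (hm1 : i + 1 < j → X.r (i + 1) s ≠ X.q (i + 2))
    (hm2 : i + 1 < j → X.r j (t + 1) ≠ X.q j)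
    (hB0 : t = s + X.k - 2 → X.r j (t + 1) ≠ X.r (j + 1) (t + 1))
    (hB1 : t < s + X.k - 2 → X.r j (t + 1) ≠ X.e (t + 1))
    (hB2 : t < s + X.k - 2 → X.e (s - 2) ≠ X.r (j + 1) (s - 1))
    (h2 : j + 1 ≤ X.n → X.r (j + 1) (s - 1) ≠ X.q (j + 2)) : False := by
  have hv := h.toValid
  rw [← perr hv] at h2 hB2
  rw [← pere hv] at hB2
  rw [show s - 1 + X.k = s + X.k - 1 by ring] at h2 hB2
  rw [show s - 2 + X.k = s + X.k - 1 - 1 by ring] at hB2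
  refine h.two hij hj h1 (trail_desc hv hst (fun hh => by rw [← hh]; exact hh ▸ hA0 hh) hA1 hA2) hm hm1 hm2
    (trail_asc hv (by omega) (fun hh => ?_) (fun hh => hB1 (by omega)) (fun hh => hB2 (by omega)))
    h2 (((List.reverse_perm _).append (List.Perm.refl _)).trans (iv_perm hv hst hts))
  rw [← hh]; exact hB0 (by omega)

theorem Losing.two_desc_desc (h : X.Losing) (i j : ℕ) (hij : i < j) (hj : j ≤ X.n) (s t : ℤ)
    (hst : s ≤ t) (hts : t ≤ s + X.k - 2)
    (h1 : 1 ≤ i → X.r i t ≠ X.q i)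
    (hA0 : s = t → X.r i s ≠ X.r (i + 1) t) (hA1 : s < t → X.r i t ≠ X.e (t - 1))
    (hA2 : s < t → X.e s ≠ X.r (i + 1) s)
    (hm : j = i + 1 → X.r j s ≠ X.r j (s - 1)) (hm1 : i + 1 < j → X.r (i + 1) s ≠ X.q (i + 2))
    (hm2 : i + 1 < j → X.r j (s - 1) ≠ X.q j)
    (hB0 : t = s + X.k - 2 → X.r j (t + 1) ≠ X.r (j + 1) (t + 1))
    (hB1 : t < s + X.k - 2 → X.r j (s - 1) ≠ X.e (s - 2))
    (hB2 : t < s + X.k - 2 → X.e (t + 1) ≠ X.r (j + 1) (t + 1))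
    (h2 : j + 1 ≤ X.n → X.r (j + 1) (t + 1) ≠ X.q (j + 2)) : False := by
  have hv := h.toValid
  rw [← perr hv _ (s - 1)] at hm hm2 hB1
  rw [← pere hv (s - 2)] at hB1
  rw [show s - 1 + X.k = s + X.k - 1 by ring] at hm hm2 hB1
  rw [show s - 2 + X.k = s + X.k - 1 - 1 by ring] at hB1
  refine h.two hij hj h1 (trail_desc hv hst (fun hh => by rw [← hh]; exact hh ▸ hA0 hh) hA1 hA2) hm hm1 hm2
    (trail_desc hv (by omega) (fun hh => ?_) (fun hh => hB1 (by omega)) (fun hh => hB2 (by omega)))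
    h2 (((List.reverse_perm _).append (List.reverse_perm _)).trans (iv_perm hv hst hts))
  rw [← hh]; exact hB0 (by omega)

/-! ### Color constraints near the start of the path. -/

theorem Losing.n_ne_zero (h : X.Losing) : X.n ≠ 0 := by
  intro hn
  have h1 := h.right
  simp only [hn, zero_add] at h1
  -- Otherwise the cycle, cut before `c s`, fits between the two path vertices. For `s = 0` the
  -- color `q 1` is on `e 0` or `e (-2)`; as consecutive cycle edges differ, `s = 1` or `s = -1`
  -- then fails.
  have key : ∀ s, X.e s = X.q 1 ∨ X.e (s - 2) = X.q 1 := by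
    intro s
    have := h.one_asc 0 (by omega) s
    have h2 := h.left s
    have h3 := h1 (s - 1)
    grind
  have e1 := h.ene 0
  have e2 := h.ene (-1)
  have e3 := h.ene (-2)
  have e4 := h.ene (-3)
  have k1 := key 0
  have k2 := key 1
  have k3 := key (-1)
  norm_num at *
  grind

/-- Otherwise the whole cycle fits between `v 0` and `v 1`, entered at `c (j + 1)` and left at `c
j`. `Losing.minus` is the opposite direction. -/
theorem Losing.plus (h : X.Losing) (hn : 1 ≤ X.n) (j : ℤ) :
    X.r 1 j = X.q 2 ∨ X.r 1 j = X.e (j - 1) ∨ X.e (j + 1) = X.q 1 := by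
  have := h.one_asc 0 (by omega) (j + 1)
  have h2 := h.left (j + 1)
  grind

theorem Losing.minus (h : X.Losing) (hn : 1 ≤ X.n) (j : ℤ) :
    X.r 1 j = X.q 2 ∨ X.r 1 j = X.e j ∨ X.e (j - 2) = X.q 1 := by
  have := h.one_desc 0 (by omega) (j - 1)
  have h2 := h.left (j - 1)
  grind

/-- Row `i` does not have the forward color at `d`. -/
def NonF (X : Config V K) (i : ℕ) (d : ℤ) : Prop := i ≤ X.n → X.r i d ≠ X.q (i + 1)

theorem Losing.asc_one (h : X.Losing) (hn : 1 ≤ X.n) {d : ℤ} (hd : X.NonF 2 d) :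
    X.r 1 (d + 1) = X.q 1 ∨ X.r 1 (d + 1) = X.e (d + 1) ∨ X.e (d - 1) = X.r 2 d := by
  have := h.one_asc 1 (by omega) (d + 1)
  unfold NonF at hd
  grind

theorem Losing.desc_one (h : X.Losing) (hn : 1 ≤ X.n) {d : ℤ} (hd : X.NonF 2 d) :
    X.r 1 (d - 1) = X.q 1 ∨ X.r 1 (d - 1) = X.e (d - 2) ∨ X.e d = X.r 2 d := by
  have := h.one_desc 1 (by omega) (d - 1)
  unfold NonF at hd
  grind

theorem Losing.plus_zero_alpha (h : X.Losing) (hn : 1 ≤ X.n) (h2 : X.r 1 0 ≠ X.q 2)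
    (h3 : X.r 1 0 ≠ X.e (-1)) (h4 : X.r 1 1 = X.r 1 0) :
    X.r 1 0 = X.e 0 ∧ X.e (-1) = X.q 1 ∧ X.e 1 = X.q 1 := by
  have p0 := h.plus hn 0
  have p1 := h.plus hn 1
  have m1 := h.minus hn 1
  have e0 := h.ene 0
  have e1 := h.ene 1
  norm_num at *
  grind

/-- Since `v 1` sees `c 0` and `c 1` in different colors, it can be placed between two arcs that end
there: `v 0`, arc, `v 1`, complementary arc, `v 2`, with the second arc left at `c d`. -/
theorem Losing.plus_zero_beta_aux (h : X.Losing) (hn : 1 ≤ X.n) (h2 : X.r 1 0 ≠ X.q 2)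
    (h3 : X.r 1 0 ≠ X.e (-1)) (h4 : X.r 1 1 ≠ X.r 1 0) {d : ℤ} (hd : X.NonF 2 d) (hd1 : 1 ≤ d)
    (hdk : d ≤ X.k) :
    X.r 1 0 = X.q 1 ∧ X.e 1 = X.q 1 ∧ X.e (-2) = X.q 1 ∧
      (d = X.k - 1 ∧ X.r 2 d = X.e (-1) ∨ d = 1) := by
  have hv := h.toValid
  have hk := h.three_le
  have p0 := h.plus hn 0
  have m0 := h.minus hn 0
  have p1 := h.plus hn 1
  have e0 := h.ene 0
  have e1 := h.ene 1
  have q1 := h.qne 1 le_rfl hn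
  have pr0 := perr hv 1 0
  have pr1 := perr hv 1 1
  have pe0 := pere hv (-1)
  have pe1 := pere hv 1
  have pe2 := pere hv 2
  norm_num at p0 m0 p1 e0 e1 q1 pr0 pr1 pe0 pe1 pe2
  have E1 : X.e 1 = X.q 1 := by grind
  have E2 : X.e 2 ≠ X.q 1 := by grind
  have E0 : X.e 0 ≠ X.q 1 := by grind
  have R1 : X.r 1 1 ≠ X.q 1 := by grind
  have hlA := h.left
  have hF : 2 ≤ X.n → X.r 2 d ≠ X.q 3 := hd
  have ed := h.ene d
  have ed1 := h.ene (d + 1)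
  have ed2 := h.ene (d - 1)
  have ed3 := h.ene (d - 2)
  have ed4 := h.ene (d - 3)
  have a1 := h.asc_one hn hd
  have d1 := h.desc_one hn hd
  ring_nf at ed ed1 ed2 ed3 ed4 a1 d1
  -- Otherwise `v 0, c (d - 1), …, c 1, v 1, c 0, c (-1), …, c d, v 2` works.
  have S1 : 2 ≤ d → X.r 2 d = X.e d := by
    intro hd2
    by_contra hne
    have t := h.two_desc_desc 0 1 (by omega) hn 1 (d - 1) (by omega) (by omega)
    have md := h.minus hn (d - 1)
    ring_nf at md t
    rcases eq_or_ne d X.k with rfl | hdk'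
    · have := h.asc_one hn hd
      grind
    · grind
  -- By `S1` the edge from `c (d - 1)` to `c d` can precede the exit to `v 2`, so `v 0, c (d + 1),
  -- …, c k = c 0, v 1, c 1, …, c d, v 2` works.
  have S2 : 2 ≤ d → d ≤ X.k - 2 → False := by
    intro hd2 hd3
    have pd := h.plus hn (d + 1)
    ring_nf at pd pr0 pr1 pe0 pe1
    have q1e : X.e (1 + d) ≠ X.q 1 := by grind
    have q2e : X.r 2 d ≠ X.e (-1 + d) := by grind
    have g1 : X.e (X.k - 1) = X.e (-1) := by rw [← pe0]; ring_nf
    have g2 : X.r 1 (X.k + 1) = X.r 1 1 := by rw [← pr1]; ring_nf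
    have g3 : X.e (X.k + 1) = X.e 1 := by rw [← pe1]; ring_nf
    refine h.two_asc_asc 0 1 (by omega) hn (d + 1) X.k (by omega) (by omega) ?_ ?_ ?_ ?_ ?_ ?_ ?_
      ?_ ?_ ?_ ?_ <;> intros <;> (try ring_nf) <;> grind
  rcases eq_or_ne d X.k with rfl | hdk'
  · have := h.asc_one hn hd
    rw [show (X.k : ℤ) + 1 = 1 + X.k by ring, show (X.k : ℤ) - 1 = -1 + X.k by ring] at this
    grind
  rcases eq_or_ne d (X.k - 1) with rfl | hdk1
  · have t := h.two_asc_asc 0 1 (by omega) hn X.k X.k (by omega) (by omega)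
    have := S1 (by omega)
    rw [show (X.k : ℤ) + 1 = 1 + X.k by ring] at t
    rw [show (X.k : ℤ) - 1 = -1 + X.k by ring] at *
    grind
  have hd1 : d = 1 := by grind
  subst hd1
  have hr0 : X.r 1 0 = X.q 1 := by
    by_contra hne
    have g0 := h.desc_one hn hd
    norm_num at g0
    have g1 : X.e (X.k - 1) = X.e (-1) := by rw [← pe0]; ring_nf
    have g2 : X.r 1 (X.k + 1) = X.r 1 1 := by rw [← pr1]; ring_nf
    have g3 : X.r 2 (X.k + 1) = X.r 2 1 := by rw [← perr hv 2 1]; ring_nf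
    refine h.two_asc_asc 0 1 (by omega) hn 2 X.k (by omega) (by omega) ?_ ?_ ?_ ?_ ?_ ?_ ?_
      ?_ ?_ ?_ ?_ <;> intros <;> norm_num <;> grind
  grind

/-- Congruence modulo the length of the cycle. -/
def Cong (X : Config V K) (a b : ℤ) : Prop := ∃ z : ℤ, a = b + z * X.k

theorem Cong.r (h : X.Valid) {a b : ℤ} (hab : X.Cong a b) (i : ℕ) : X.r i a = X.r i b := by
  obtain ⟨z, rfl⟩ := hab; exact perr_mul h _ _ _

theorem Cong.e (h : X.Valid) {a b : ℤ} (hab : X.Cong a b) (s : ℤ) : X.e (a + s) = X.e (b + s) := by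
  obtain ⟨z, rfl⟩ := hab
  rw [add_right_comm]; exact pere_mul h _ _

theorem exists_rep (h : X.Valid) (d s : ℤ) : ∃ d', X.Cong d' d ∧ s ≤ d' ∧ d' < s + X.k := by
  have hk := h.three_le
  have h0 := Int.emod_nonneg (d - s) (show (X.k : ℤ) ≠ 0 by omega)
  have h1 := Int.emod_lt_of_pos (d - s) (show (0 : ℤ) < X.k by omega)
  have h2 := Int.emod_add_mul_ediv (d - s) X.k
  refine ⟨s + (d - s) % X.k, ⟨-((d - s) / X.k), by grind⟩, by omega, by omega⟩

theorem Losing.plus_zero_beta (h : X.Losing) (hn : 1 ≤ X.n) (h2 : X.r 1 0 ≠ X.q 2)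
    (h3 : X.r 1 0 ≠ X.e (-1)) (h4 : X.r 1 1 ≠ X.r 1 0) {d : ℤ} (hd : X.NonF 2 d) :
    X.r 1 0 = X.q 1 ∧ X.e 1 = X.q 1 ∧ X.e (-2) = X.q 1 ∧
      (X.Cong d (-1) ∧ X.r 2 d = X.e (-1) ∨ X.Cong d 1 ∧ X.r 2 d = X.e 0) := by
  have hv := h.toValid
  have hk := h.three_le
  obtain ⟨d', hc, hd1, hdk⟩ := exists_rep hv d 1
  have hd' : X.NonF 2 d' := by unfold NonF at *; rwa [hc.r hv]
  obtain ⟨r0, e1, e2, hh⟩ := h.plus_zero_beta_aux hn h2 h3 h4 hd' hd1 (by omega)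
  have hcd : ∀ z, X.Cong d' z → X.Cong d z := by
    rintro z ⟨m, hm⟩; obtain ⟨m', hm'⟩ := hc; exact ⟨m - m', by grind⟩
  refine ⟨r0, e1, e2, ?_⟩
  rw [← hc.r hv]
  rcases hh with ⟨hz, hh⟩ | hz
  · exact .inl ⟨hcd _ ⟨1, by rw [hz]; ring⟩, hh⟩
  -- For `d = 1` the color of the edge to `v 2` comes from the reflected cycle. Its other
  -- alternative would make `1` and `-1` congruent, against `k ≥ 3`.
  obtain ⟨d'', hc', hd1', hdk'⟩ := exists_rep hv (-d) 1
  have hd'' : X.refl.NonF 2 d'' := by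
    unfold NonF at *
    rw [hc'.r hv.refl]
    simpa using hd
  have e0 := h.ene 0
  have q1 := h.qne 1 le_rfl hn
  have m1 := h.minus hn (-1)
  have em1 := h.ene (-2)
  have em2 := h.ene (-3)
  norm_num at *
  have := h.refl.plus_zero_beta_aux hn (by simpa using h2) (by simp [refl_e hv]; grind)
    (by simp; grind) hd'' hd1' (by simp; omega)
  simp only [refl_e hv, refl_k, refl_r] at this
  have hneg : X.Cong (-d'') d := by
    obtain ⟨m, hm⟩ := hc'; exact ⟨-m, by rw [hm]; ring⟩
  obtain ⟨-, -, -, ⟨hx, hy⟩ | hx⟩ := this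
  · refine .inr ⟨hcd _ ⟨0, by simpa using hz⟩, ?_⟩
    norm_num at hy
    rw [← hy, hneg.r hv, hc.r hv]
  · exfalso
    obtain ⟨m, hm⟩ := hneg
    obtain ⟨m', hm'⟩ := hc
    have h2 : (2 : ℤ) = (m' - m) * X.k := by rw [sub_mul]; omega
    have := Int.le_of_dvd (by norm_num) (Dvd.intro_left _ h2.symm)
    omega

/-! ### Shortest counterexamples and the two kinds of non-forward edges at `v 1`. -/

/-- Delete the first `i` vertices of the path. -/
def drop (X : Config V K) (i : ℕ) : Config V K :=
  { X with n := X.n - i, v := fun t => X.v (i + t), q := fun t => X.q (i + t) }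

/-- The vertex `v i` meets the requirement on a start vertex. A Hamilton path of the shorter
configuration starts with an edge of color `q (i + 1)`, so the deleted initial segment can be put
back in front of it. -/
theorem Losing.drop (h : X.Losing) {i : ℕ} (hi : 1 ≤ i) (hin : i ≤ X.n)
    (hF : ∀ d, X.r i d = X.q (i + 1)) : (X.drop i).Losing where
  symm := h.symm
  three_le := h.three_le
  injv a b ha hb hab := by
    simp only [Config.drop] at ha hb hab
    have := h.injv _ _ (by omega) (by omega) hab
    omega
  perc := h.perc
  injc := h.injc
  disj a b ha := h.disj _ _ (by simp only [Config.drop] at ha; omega)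
  hq a ha := h.hq (i + a) (by simp only [Config.drop] at ha; omega)
  qne a ha ha' := by
    simp only [Config.drop] at ha'
    exact h.qne (i + a) (by omega) (by omega)
  ene := h.ene
  left := hF
  right j := by
    have := h.right j
    simpa [Config.drop, Config.r, show i + (X.n - i + 1) = X.n + 1 by omega] using this
  no := by
    rintro ⟨L, hL, ht⟩
    refine h.no ⟨seg X.v 0 (i - 1) ++ L, ?_, fun ξ η hξ hη => ?_⟩
    · have e1 := seg_append X.v 0 (i - 1) i (X.n - i + 1) (by omega)
      rw [show i - 1 + 1 + (X.n - i + 1) = X.n + 1 by omega] at e1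
      rw [verts, ← e1, List.append_assoc]
      refine (List.Perm.refl _).append (hL.trans ?_)
      have e2 : seg (X.drop i).v 0 (X.n - i + 1) = seg X.v i (X.n - i + 1) := by
        simp [seg, Config.drop]
      rw [← e2]
      exact List.Perm.refl _
    · have e1 := h.hq (i - 1) (by omega)
      rw [show i - 1 + 1 = i by omega] at e1
      have t1 := trail_seg h.toValid (i := 0) (j := i - 1) (by omega) (by omega) (α := ξ)
        (β := X.q i) (fun hh => by rw [show i = 1 by omega]; exact hξ) (fun _ => hξ)
        (fun hh => by
          have := h.qne (i - 1) (by omega) (by omega)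
          rwa [show i - 1 + 1 = i by omega] at this)
      have t2 := ht (X.q i) η (h.qne i hi hin)
        (by simpa [Config.drop, show i + (X.n - i + 1) = X.n + 1 by omega] using hη)
      have := t1.glue t2 e1
      simpa [Config.drop, show i + (X.n - i + 1) = X.n + 1 by omega] using this

/-- A shortest counterexample. -/
structure Minimal (X : Config V K) : Prop extends X.Losing where
  min : ∀ Y : Config V K, Y.n < X.n → Y.k = X.k → ¬ Y.Losing

theorem Minimal.shift (h : X.Minimal) (s : ℤ) : (X.shift s).Minimal := ⟨h.toLosing.shift s, h.min⟩
theorem Minimal.refl (h : X.Minimal) : X.refl.Minimal := ⟨h.toLosing.refl, h.min⟩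
theorem Minimal.rev (h : X.Minimal) : X.rev.Minimal := ⟨h.toLosing.rev, h.min⟩

theorem Minimal.exists_nonF (h : X.Minimal) {i : ℕ} (hi : 1 ≤ i) (hin : i ≤ X.n) :
    ∃ d, X.r i d ≠ X.q (i + 1) := by
  by_contra! hF
  exact h.min (X.drop i) (by simp only [Config.drop]; omega) rfl (h.toLosing.drop hi hin hF)

theorem Minimal.exists_nonB (h : X.Minimal) {i : ℕ} (hi : 1 ≤ i) (hin : i ≤ X.n) :
    ∃ d, X.r i d ≠ X.q i := by
  obtain ⟨d, hd⟩ := h.rev.exists_nonF (i := X.n + 1 - i) (by omega) (by simp; omega)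
  refine ⟨d, ?_⟩
  simpa [show X.n + 1 - (X.n + 1 - i) = i by omega, show X.n + 2 - (X.n + 1 - i + 1) = i by omega]
    using hd

theorem Minimal.n_pos (h : X.Minimal) : 1 ≤ X.n := Nat.one_le_iff_ne_zero.2 h.n_ne_zero

theorem Minimal.exists_NonF_two (h : X.Minimal) : ∃ d, X.NonF 2 d := by
  by_cases h2 : 2 ≤ X.n
  · obtain ⟨d, hd⟩ := h.exists_nonF (i := 2) (by omega) h2
    exact ⟨d, fun _ => hd⟩
  · exact ⟨0, fun h => absurd h h2⟩

/-- Two consecutive vertices of the cycle are joined to `v 1` by edges of the color of the cycle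
edge between them, and this edge lies between two edges of the color `q 1`. -/
def Alpha (X : Config V K) (j : ℤ) : Prop :=
  X.r 1 j ≠ X.q 2 ∧ X.r 1 j = X.e j ∧ X.r 1 (j + 1) = X.e j ∧ X.e (j - 1) = X.q 1 ∧
    X.e (j + 1) = X.q 1

/-- The edge from `v 1` to `c j` and the cycle edges at distance one from `c j` have color `q 1`,
and `v 2` can only be joined to `c (j - 1)` or `c (j + 1)` without using the forward color. -/
def Beta (X : Config V K) (j : ℤ) : Prop :=
  X.r 1 j = X.q 1 ∧ X.e (j + 1) = X.q 1 ∧ X.e (j - 2) = X.q 1 ∧ ∀ d, X.NonF 2 d →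
    (X.Cong d (j - 1) ∧ X.r 2 d = X.e (j - 1)) ∨ (X.Cong d (j + 1) ∧ X.r 2 d = X.e j)

theorem Minimal.plus_zero (h : X.Minimal) (h2 : X.r 1 0 ≠ X.q 2) (h3 : X.r 1 0 ≠ X.e (-1)) :
    X.Alpha 0 ∨ X.Beta 0 := by
  have hn := h.n_pos
  by_cases h4 : X.r 1 1 = X.r 1 0
  · obtain ⟨a, b, c⟩ := h.plus_zero_alpha hn h2 h3 h4
    exact .inl ⟨h2, a, by simpa using h4.trans a, by simpa using b, by simpa using c⟩
  · obtain ⟨d, hd⟩ := h.exists_NonF_two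
    obtain ⟨a, b, c, -⟩ := h.plus_zero_beta hn h2 h3 h4 hd
    refine .inr ⟨a, by simpa using b, by simpa using c, fun d hd => ?_⟩
    simpa using (h.plus_zero_beta hn h2 h3 h4 hd).2.2.2

theorem alpha_shift {s j : ℤ} : (X.shift s).Alpha j ↔ X.Alpha (j + s) := by
  simp only [Alpha, shift_r, shift_q, shift_e, add_sub_right_comm, add_right_comm]

theorem nonF_shift {s : ℤ} {i : ℕ} {d : ℤ} : (X.shift s).NonF i d ↔ X.NonF i (d + s) := Iff.rfl

theorem beta_shift {s j : ℤ} : (X.shift s).Beta j ↔ X.Beta (j + s) := by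
  simp only [Beta, shift_r, shift_q, shift_e, nonF_shift]
  rw [show j + 1 + s = j + s + 1 by ring, show j - 2 + s = j + s - 2 by ring,
    show j - 1 + s = j + s - 1 by ring]
  refine and_congr_right' (and_congr_right' (and_congr_right' ⟨fun H d hd => ?_, fun H d hd => ?_⟩))
  · have := H (d - s) (by simpa using hd)
    simp only [sub_add_cancel] at this
    refine this.imp (And.imp_left ?_) (And.imp_left ?_) <;> rintro ⟨z, hz⟩ <;>
      exact ⟨z, by simp at hz; linarith⟩
  · have := H (d + s) hd
    refine this.imp (And.imp_left ?_) (And.imp_left ?_) <;> rintro ⟨z, hz⟩ <;>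
      exact ⟨z, by simp; linarith⟩

theorem alpha_refl (h : X.Valid) {j : ℤ} (hj : X.refl.Alpha (-j)) : X.Alpha (j - 1) := by
  simp only [Alpha, refl_e h, refl_r, refl_q] at *
  ring_nf at *
  grind

theorem beta_refl (h : X.Valid) {j : ℤ} (hj : X.refl.Beta (-j)) : X.Beta j := by
  simp only [Beta, refl_e h, refl_r, refl_q] at *
  obtain ⟨a, b, c, hh⟩ := hj
  ring_nf at a b c
  refine ⟨a, by rw [← c]; ring_nf, by rw [← b]; ring_nf, fun d hd => ?_⟩
  have := hh (-d) (by unfold NonF at *; simpa using hd)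
  ring_nf at this ⊢
  refine this.symm.imp (And.imp_left ?_) (And.imp_left ?_) <;> rintro ⟨z, hz⟩ <;>
    exact ⟨-z, by simp at hz; linarith⟩

theorem Minimal.plus_cases (h : X.Minimal) {j : ℤ} (h2 : X.r 1 j ≠ X.q 2)
    (h3 : X.r 1 j ≠ X.e (j - 1)) : X.Alpha j ∨ X.Beta j := by
  have := (h.shift j).plus_zero (by simpa using h2) (by simpa [neg_add_eq_sub] using h3)
  simpa [alpha_shift, beta_shift] using this

/-- The color cannot equal both `e (j - 1)` and `e j`, so `Minimal.plus_cases` applies to the cycle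
or to its reflection; reflection turns the kind `Alpha` at `-j` into `Alpha` at `j - 1`. -/
theorem Minimal.nonF_cases (h : X.Minimal) {j : ℤ} (h2 : X.r 1 j ≠ X.q 2) :
    X.Alpha j ∨ X.Alpha (j - 1) ∨ X.Beta j := by
  by_cases h3 : X.r 1 j = X.e (j - 1)
  · have e0 := h.ene (j - 1)
    have := h.refl.plus_cases (j := -j) (by simpa using h2)
      (by
        rw [refl_e h.toValid, show -(-j - 1) - 1 = j by ring, refl_r, neg_neg, h3]
        simpa using e0)
    rcases this with this | this
    · exact .inr (.inl (alpha_refl h.toValid this))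
    · exact .inr (.inr (beta_refl h.toValid this))
  · exact (h.plus_cases h2 h3).imp_right .inr

theorem not_cong {a b : ℤ} (h1 : a < b) (h2 : b < a + X.k) : ¬ X.Cong a b := by
  rintro ⟨z, hz⟩
  have : (0 : ℤ) < X.k := by omega
  have h3 : -1 < z := by nlinarith
  have h4 : z < 0 := by nlinarith
  omega

theorem not_cong' {a b : ℤ} (h1 : b < a) (h2 : a < b + X.k) : ¬ X.Cong a b := by
  rintro ⟨z, hz⟩
  have : (0 : ℤ) < X.k := by omega
  have h3 : 0 < z := by nlinarith
  have h4 : z < 1 := by nlinarith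
  omega

/-- For `n = 1` the vertex `v 2` is the end and `NonF 2` holds vacuously everywhere, in particular
at `j`, which `Beta j` forbids. `Alpha` fails by inserting the cycle between `v 1` and `v 2`. -/
theorem Minimal.two_le (h : X.Minimal) : 2 ≤ X.n := by
  by_contra hn
  have hn1 : X.n = 1 := by have := h.n_pos; omega
  have hk := h.three_le
  obtain ⟨j, hj⟩ := h.exists_nonF (i := 1) le_rfl (by omega)
  have hα : ∀ j, ¬ X.Alpha j := by
    intro j ⟨h1, h2, h3, h4, h5⟩
    have := h.asc_one (d := j) (by omega) (fun h => by omega)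
    have hr := h.right j
    have e0 := h.ene j
    have q1 := h.qne 1 le_rfl (by omega)
    simp only [hn1] at hr
    norm_num at hr q1
    grind
  rcases h.nonF_cases hj with hj | hj | hj
  · exact hα _ hj
  · exact hα _ hj
  · rcases hj.2.2.2 j (fun h => by omega) with ⟨hc, -⟩ | ⟨hc, -⟩
    · exact not_cong' (by omega) (by omega) hc
    · exact not_cong (by omega) (by omega) hc

theorem rev_q_one : X.rev.q 1 = X.q (X.n + 1) := by simp
theorem rev_q_two : X.rev.q 2 = X.q X.n := by simp
theorem rev_r_one (j : ℤ) : X.rev.r 1 j = X.r X.n j := by simp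

theorem Cong.trans {a b d : ℤ} (h : X.Cong a b) (h' : X.Cong b d) : X.Cong a d := by
  obtain ⟨m, hm⟩ := h; obtain ⟨m', hm'⟩ := h'
  exact ⟨m + m', by rw [hm, hm']; ring⟩

theorem Cong.symm {a b : ℤ} (h : X.Cong a b) : X.Cong b a := by
  obtain ⟨m, hm⟩ := h
  exact ⟨-m, by rw [hm]; ring⟩

theorem Losing.alpha_ne (h : X.Losing) {j : ℤ} (ha : X.Alpha j) : X.r 1 j ≠ X.q 1 := by
  obtain ⟨h1, h2, h3, h4, h5⟩ := ha
  have := h.ene j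
  grind

theorem Losing.alpha_ne' (h : X.Losing) {j : ℤ} (ha : X.Alpha (j - 1)) : X.r 1 j ≠ X.q 1 := by
  obtain ⟨h1, h2, h3, h4, h5⟩ := ha
  have := h.ene (j - 1)
  grind

theorem Minimal.beta_of_eq (h : X.Minimal) {j : ℤ} (hj : X.r 1 j = X.q 1) : X.Beta j := by
  have := h.qne 1 le_rfl h.n_pos
  rcases h.nonF_cases (j := j) (by rw [hj]; exact this) with ha | ha | hb
  · exact absurd hj (h.alpha_ne ha)
  · exact absurd hj (h.alpha_ne' ha)
  · exact hb

/-! ### Equal end colors are impossible for cycles of length at least four. -/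

/-- If both end colors agree and no edge from `v 1` to the cycle has the end color, the right end
cannot be of the first kind. -/
theorem Minimal.not_alpha_rev (h : X.Minimal) (hxy : X.q 1 = X.q (X.n + 1))
    (hB : ∀ j, ¬ X.Beta j) : ¬ X.rev.Alpha 0 := by
  intro ⟨a1, a2, a3, a4, a5⟩
  rw [rev_r_one] at a1 a2 a3
  rw [rev_q_two] at a1
  rw [rev_q_one] at a4 a5
  rw [rev_e] at a2 a3 a4 a5
  have hv := h.toValid
  have hk := h.three_le
  have hn := h.two_le
  have hx : ∀ j, X.r 1 j ≠ X.q 1 := fun j hj => hB j (h.beta_of_eq hj)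
  have hr := h.right
  have hx0 := hx 0
  have hx1 := hx 1
  have e0 := h.ene 0
  have em1 := h.ene (-1)
  have em2 := h.ene (-2)
  have e1 := h.ene 1
  norm_num at a3 a4 a5 e0 e1 em1 em2
  by_cases hn2 : X.n = 2
  · have := h.asc_one (d := 0) (by omega) (fun _ => by rw [← hn2, a2, hn2]; grind)
    norm_num [hn2] at *
    grind
  obtain ⟨d₀, hd₀⟩ := h.exists_nonF (i := 2) (by omega) hn
  obtain ⟨d, hc, hd1, hdk⟩ := exists_rep hv d₀ 1
  rw [← hc.r hv] at hd₀
  have hd : X.NonF 2 d := fun _ => hd₀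
  clear hc
  -- Row 1 avoids `q 1`. Hence `r 2 d ≠ e (d - 1)` gives `e (d + 1) ≠ q 1`, and `r 2 d ≠ e d` gives
  -- `e (d - 2) ≠ q 1`: these are the conditions for entering the last vertex in `f1` and `f2`.
  have as := h.asc_one (by omega) hd
  have ds := h.desc_one (by omega) hd
  have ed1 := h.ene (d - 1)
  rw [sub_add_cancel] at ed1
  have g0 : X.r X.n X.k = X.r X.n 0 := by rw [← perr hv X.n 0, zero_add]
  have g1 : X.r X.n (X.k + 1) = X.r X.n 1 := by rw [← perr hv X.n 1, add_comm]
  have g2 : X.r 1 X.k = X.r 1 0 := by rw [← perr hv 1 0, zero_add]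
  have g3 : X.r 1 (X.k + 1) = X.r 1 1 := by rw [← perr hv 1 1, add_comm]
  have g4 : X.e (X.k - 1) = X.e (-1) := by rw [← pere hv (-1)]; ring_nf
  have g5 : X.e (X.k + 1) = X.e 1 := by rw [← pere hv 1]; ring_nf
  have g6 : X.e (X.k - 2) = X.e (-2) := by rw [← pere hv (-2)]; ring_nf
  rcases eq_or_ne d X.k with rfl | hdk'
  · refine h.two_asc_asc 1 X.n (by omega) le_rfl X.k X.k le_rfl (by omega) ?_ ?_ ?_ ?_ ?_ ?_ ?_
      ?_ ?_ ?_ ?_ <;> intros <;> (try ring_nf) <;> grind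
  rcases eq_or_ne d 1 with rfl | hd1'
  · refine h.two_asc_desc 1 X.n (by omega) le_rfl 1 1 le_rfl (by omega) ?_ ?_ ?_ ?_ ?_ ?_ ?_
      ?_ ?_ ?_ ?_ <;> intros <;> norm_num at * <;> grind
  -- The detours are `v 1, c 1, …, c d, v 2` and `v n, c 0, c (-1), …, c (d + 1), v (n + 1)`. In
  -- `f2` the roles of `c 0` and `c 1` are exchanged; `f1` and `f2` together contradict properness
  -- at `c d`.
  have f1 : X.r 2 d = X.e (d - 1) := by
    by_contra hne
    refine h.two_asc_desc 1 X.n (by omega) le_rfl 1 d (by omega) (by omega) ?_ ?_ ?_ ?_ ?_ ?_ ?_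
      ?_ ?_ ?_ ?_ <;> intros <;> norm_num at * <;> grind
  have f2 : X.r 2 d = X.e d := by
    by_contra hne
    refine h.two_desc_asc 1 X.n (by omega) le_rfl d X.k (by omega) (by omega) ?_ ?_ ?_ ?_ ?_ ?_ ?_
      ?_ ?_ ?_ ?_ <;> intros <;> norm_num at * <;> grind
  grind

/-- For `t` in `[0, k)` the detours are `v 1, c (t + 1), …, c (k - 1), v 2` and `v n, c t, …, c 0, v
(n + 1)`. They fail only when the second one is the single vertex `c 0` and its two edges share the
end color. -/
theorem Minimal.right_of_beta_aux (h : X.Minimal) (hk4 : 4 ≤ X.k) (hxy : X.q 1 = X.q (X.n + 1))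
    (hB : X.Beta 0) (hF : X.NonF 2 (-1)) (hr2 : X.r 2 (-1) = X.e (-1)) {t : ℤ}
    (ht : X.r X.n t ≠ X.q X.n) (ht' : X.r X.n t ≠ X.e (t - 1)) :
    X.Cong t 0 ∧ X.r X.n t = X.q 1 := by
  have hv := h.toValid
  have hk := h.three_le
  have hn := h.two_le
  obtain ⟨t, hc, ht0, htk⟩ := exists_rep hv t 0
  have hee := hc.e hv (-1)
  simp only [← sub_eq_add_neg] at hee
  rw [← hc.r hv] at ht ht'
  rw [← hee] at ht'
  suffices X.Cong t 0 ∧ X.r X.n t = X.q 1 from ⟨hc.symm.trans this.1, by rw [← hc.r hv]; exact this.2⟩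
  clear hc hee
  have hr := h.right
  obtain ⟨b1, b2, b3, b4⟩ := id hB
  have e0 := h.ene 0
  have em2 := h.ene (-2)
  have em1 := h.ene (-1)
  have et := h.ene t
  have et' := h.ene (t + 1)
  have e1 := h.ene 1
  norm_num at b2 b3 e0 e1 em1 em2
  have g2 : X.r 2 (X.k - 1) = X.r 2 (-1) := by rw [← perr hv 2 (-1)]; ring_nf
  have g3 : X.r X.n (t + X.k) = X.r X.n t := perr hv _ _
  have g4 : X.e (X.k - 1) = X.e (-1) := by rw [← pere hv (-1)]; ring_nf
  have g5 : X.e X.k = X.e 0 := by rw [← pere hv 0]; ring_nf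
  have g6 : X.e (X.k - 2) = X.e (-2) := by rw [← pere hv (-2)]; ring_nf
  have g7 : X.r X.n X.k = X.r X.n 0 := by rw [← perr hv X.n 0, zero_add]
  have hF' := hF hn
  have hF'' : X.r 2 (-1) ≠ X.q 3 := hF'
  have pc := h.rev.plus_cases (j := t) (by rw [rev_r_one, rev_q_two]; exact ht)
    (by rw [rev_r_one, rev_e]; exact ht')
  have pt : X.e (t + 1) = X.q 1 := by
    rw [hxy, ← rev_q_one]
    rcases pc with ⟨_, _, _, _, p⟩ | ⟨_, p, _⟩ <;> exact p
  -- For `n = 2` both detours meet at `v 2`. Here `k ≥ 4` is needed: one of the cases would make `k`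
  -- divide 3.
  have hn2 : X.n = 2 → X.r 2 (-1) ≠ X.r 2 t := by
    intro hn2 heq
    rcases pc with ⟨-, p1, p2, p3, p4⟩ | ⟨p, -⟩
    · rw [rev_e, rev_r_one, hn2] at p1 p2
      have hne : X.e t ≠ X.q 3 := by rw [hn2] at hxy; grind
      have c1 := b4 t (fun _ => by rw [p1]; exact hne)
      have c2 := b4 (t + 1) (fun _ => by rw [p2]; exact hne)
      norm_num at c1 c2
      rcases c1 with ⟨⟨z, hz⟩, -⟩ | ⟨⟨z, hz⟩, -⟩ <;> rcases c2 with ⟨⟨w, hw⟩, -⟩ | ⟨⟨w, hw⟩, -⟩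
      · have h1 : (1 : ℤ) = (w - z) * X.k := by rw [sub_mul]; omega
        have := Int.le_of_dvd (by norm_num) (Dvd.intro_left _ h1.symm)
        omega
      · have h1 : (1 : ℤ) = (z - w) * X.k := by rw [sub_mul]; omega
        have := Int.le_of_dvd (by norm_num) (Dvd.intro_left _ h1.symm)
        omega
      · have h1 : (3 : ℤ) = (w - z) * X.k := by rw [sub_mul]; omega
        have := Int.le_of_dvd (by norm_num) (Dvd.intro_left _ h1.symm)
        omega
      · have h1 : (1 : ℤ) = (w - z) * X.k := by rw [sub_mul]; omega
        have := Int.le_of_dvd (by norm_num) (Dvd.intro_left _ h1.symm)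
        omega
    · rw [rev_r_one, rev_q_one, hn2] at p
      rw [hn2] at hxy
      grind
  rcases eq_or_ne t (X.k - 1) with rfl | ht1
  · exfalso; norm_num at pt; grind
  rcases eq_or_ne t (X.k - 2) with rfl | ht2
  · exfalso; rw [show (X.k : ℤ) - 2 + 1 = X.k - 1 by ring] at pt; grind
  rcases eq_or_ne t 0 with rfl | ht3
  · refine ⟨⟨0, by simp⟩, ?_⟩
    by_contra hs
    have r1 : X.r 1 1 ≠ X.q 1 := by
      intro hh
      have := (h.beta_of_eq hh).2.1
      norm_num at this
      grind
    refine h.two_asc_desc 1 X.n (by omega) le_rfl 1 (X.k - 1) (by omega) (by omega) ?_ ?_ ?_ ?_ ?_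
      ?_ ?_ ?_ ?_ ?_ ?_ <;> intros <;> norm_num at * <;> grind
  exfalso
  -- Otherwise `Beta (t + 1)` would place the non-forward neighbor `c (-1)` of `v 2` next to `c (t +
  -- 1)`.
  have r1 : X.r 1 (t + 1) ≠ X.q 1 := by
    intro hh
    obtain ⟨-, -, -, p⟩ := h.beta_of_eq hh
    rcases p (-1) hF with ⟨hc, p⟩ | ⟨hc, p⟩
    · exact not_cong (by omega) (by omega) hc
    · rw [pt] at p; grind
  refine h.two_asc_desc 1 X.n (by omega) le_rfl (t + 1) (X.k - 1) (by omega) (by omega) ?_ ?_ ?_ ?_ ?_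
    ?_ ?_ ?_ ?_ ?_ ?_ <;> intros <;> (try ring_nf) <;> grind

theorem nonF_cong (h : X.Valid) {i : ℕ} {a b : ℤ} (hab : X.Cong a b) :
    X.NonF i a ↔ X.NonF i b := by
  unfold NonF; rw [hab.r h]

theorem Minimal.right_of_beta (h : X.Minimal) (hk4 : 4 ≤ X.k) (hxy : X.q 1 = X.q (X.n + 1))
    (hB : X.Beta 0) {t : ℤ} (ht : X.r X.n t ≠ X.q X.n) : X.Cong t 0 ∧ X.r X.n t = X.q 1 := by
  have hv := h.toValid
  have hn := h.two_le
  have key : ∀ t, X.r X.n t ≠ X.q X.n → X.r X.n t ≠ X.e (t - 1) →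
      X.Cong t 0 ∧ X.r X.n t = X.q 1 := by
    intro t ht ht'
    obtain ⟨d, hd⟩ := h.exists_NonF_two
    rcases hB.2.2.2 d hd with ⟨hc, hr⟩ | ⟨hc, hr⟩
    · exact h.right_of_beta_aux hk4 hxy hB ((nonF_cong hv hc).1 hd) (by
        rw [hc.r hv] at hr; simpa using hr) ht ht'
    · have hB' : X.refl.Beta 0 := h.refl.beta_of_eq (by simpa using hB.1)
      have hd' := (nonF_cong hv hc).1 hd
      rw [hc.r hv] at hr
      have e0 := h.ene (t - 1)
      rw [sub_add_cancel] at e0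
      have hβ : X.rev.Alpha t ∨ X.rev.Beta t :=
        h.rev.plus_cases (by rwa [rev_r_one, rev_q_two]) (by rwa [rev_r_one, rev_e])
      have hB2 : X.q (X.n + 1) = X.e (t + 1) := by
        rw [← rev_q_one]
        rcases hβ with ⟨_, _, _, _, p⟩ | ⟨_, p, _⟩ <;> exact p.symm
      have base := fun u hu hu' => h.refl.right_of_beta_aux (t := u) hk4 hxy hB'
        (by unfold NonF at hd' ⊢; simpa using hd') (by
          rw [refl_r, refl_e hv]; simpa using hr) (by simpa using hu) (by
          rw [refl_r, refl_e hv, refl_n]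
          rw [show -(u - 1) - 1 = -u by ring]
          exact hu')
      rcases hβ with ⟨a1, a2, a3, a4, a5⟩ | ⟨b1, b2, b3, -⟩
      · exfalso
        rw [rev_r_one, rev_q_two] at a1
        rw [rev_r_one, rev_e] at a2 a3
        have e1 := h.ene t
        have := base (-(t + 1)) (by rw [neg_neg, a3, ← a2]; exact a1)
          (by rw [neg_neg, a3]; exact e1)
        have := this.2
        rw [refl_r, neg_neg, refl_n, a3, refl_q, hxy] at this
        grind
      · rw [rev_r_one] at b1
        rw [rev_q_one] at b1 b2 b3
        rw [rev_e] at b2 b3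
        have e1 := h.ene t
        have := base (-t) (by rw [neg_neg]; exact ht) (by rw [neg_neg]; grind)
        refine ⟨?_, by rw [b1, hxy]⟩
        obtain ⟨⟨z, hz⟩, -⟩ := this
        exact ⟨-z, by simp at hz; linarith⟩
  by_cases ht' : X.r X.n t = X.e (t - 1)
  · have e0 := h.ene (t - 1)
    rw [sub_add_cancel] at e0
    rcases h.rev.nonF_cases (j := t) (by rwa [rev_r_one, rev_q_two]) with ha | ha | hb
    · obtain ⟨a1, a2, a3, a4, a5⟩ := ha
      rw [rev_r_one, rev_e] at a2
      exact absurd (ht'.symm.trans a2) e0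
    · obtain ⟨a1, a2, a3, a4, a5⟩ := ha
      have e1 := h.ene (t - 1 - 1)
      rw [sub_add_cancel] at e1 a5
      rw [rev_r_one, rev_e] at a2
      rw [rev_r_one, rev_q_two] at a1
      have := (key (t - 1) a1 (by rw [a2]; exact e1.symm)).2
      rw [rev_e, rev_q_one] at a5
      grind
    · obtain ⟨b1, b2, b3, -⟩ := hb
      have e1 := h.ene (t - 2)
      rw [show t - 2 + 1 = t - 1 by ring] at e1
      rw [rev_r_one] at b1
      rw [rev_e] at b3
      grind
  · exact key t ht ht'

/-- Applying `Minimal.right_of_beta` from both ends, `c 0` is the only vertex that `v n` sees in a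
non-backward color and the only one that `v 1` sees in a non-forward color. -/
theorem Minimal.false_of_beta_aux (h : X.Minimal) (hk4 : 4 ≤ X.k) (hxy : X.q 1 = X.q (X.n + 1))
    (hB : X.Beta 0) (hF : X.NonF 2 (-1)) (hr2 : X.r 2 (-1) = X.e (-1)) : False := by
  have hv := h.toValid
  have hn := h.two_le
  obtain ⟨t, ht⟩ := h.exists_nonB (i := X.n) (by omega) le_rfl
  obtain ⟨hc, hs⟩ := h.right_of_beta hk4 hxy hB ht
  rw [hc.r hv] at ht hs
  have hB' : X.rev.Beta 0 := h.rev.beta_of_eq (by rw [rev_r_one, rev_q_one, hs, hxy])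
  have hl : ∀ j, X.r 1 j ≠ X.q 2 → X.Cong j 0 := by
    intro j hj
    refine (h.rev.right_of_beta hk4 ?_ hB' (t := j) ?_).1
    · simp [hxy]
    · simpa using hj
  obtain ⟨b1, b2, b3, b4⟩ := hB
  have r1 : X.r 1 1 = X.q 2 := by
    by_contra hh; exact not_cong' (by omega) (by omega) (hl 1 hh)
  have r2 : X.r 1 (X.k - 1) = X.q 2 := by
    by_contra hh; exact not_cong' (by omega) (by omega) (hl _ hh)
  have g2 : X.r 2 (X.k - 1) = X.r 2 (-1) := by rw [← perr hv 2 (-1)]; ring_nf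
  have g4 : X.e (X.k - 1) = X.e (-1) := by rw [← pere hv (-1)]; ring_nf
  have g5 : X.e (X.k - 3) = X.e (-3) := by rw [← pere hv (-3)]; ring_nf
  have g6 : X.e (X.k - 2) = X.e (-2) := by rw [← pere hv (-2)]; ring_nf
  have hF'' : X.r 2 (-1) ≠ X.q 3 := hF hn
  have hlA := h.left
  have hr := h.right
  have e0 := h.ene 0
  have em3 := h.ene (-3)
  have em2 := h.ene (-2)
  have em1 := h.ene (-1)
  have e1 := h.ene 1
  have q1 := h.qne 1 le_rfl (by omega)
  norm_num at b2 b3 e0 e1 em1 em2 em3 q1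
  have q2 : X.q 2 = X.e (-1) := by
    by_contra hh
    refine h.two_desc_asc 0 1 (by omega) (by omega) 0 (X.k - 2) (by omega) (by omega) ?_ ?_ ?_ ?_ ?_
      ?_ ?_ ?_ ?_ ?_ ?_ <;> intros <;> (try ring_nf at *) <;> grind
  by_cases hn2 : X.n = 2
  · refine h.two_desc_desc 1 2 (by omega) (by omega) 0 1 (by omega) (by omega) ?_ ?_ ?_ ?_ ?_
      ?_ ?_ ?_ ?_ ?_ ?_ <;> intros <;> norm_num at * <;> grind
  -- The path goes `v 1, c 1, c 0, v n`, then back along the path to `v 2`, then `c (-1), …, c 2, v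
  -- (n + 1)`.
  · refine h.three (i := 1) (j := X.n) (by omega) le_rfl (a := 1) (a' := 0)
      (b := 0 + X.k - 1) (b' := 1 + 1) (by grind)
      (trail_desc hv (by omega) ?_ ?_ ?_) ht ?_ (trail_desc hv (by omega) ?_ ?_ ?_) (by omega)
      (((List.reverse_perm _).append (List.reverse_perm _)).trans
        (iv_perm hv (s := 0) (t := 1) (by omega) (by omega))) <;>
      intros <;> norm_num at * <;> grind

theorem Minimal.false_of_beta (h : X.Minimal) (hk4 : 4 ≤ X.k) (hxy : X.q 1 = X.q (X.n + 1))
    {j : ℤ} (hB : X.Beta j) : False := by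
  wlog hj : j = 0 generalizing X j
  · exact this (h.shift j) (j := 0) hk4 hxy (by simpa [beta_shift] using hB) rfl
  subst hj
  have hv := h.toValid
  obtain ⟨d, hd⟩ := h.exists_NonF_two
  rcases hB.2.2.2 d hd with ⟨hc, hr⟩ | ⟨hc, hr⟩
  · exact h.false_of_beta_aux hk4 hxy hB ((nonF_cong hv hc).1 hd) (by
        rw [hc.r hv] at hr; simpa using hr)
  · have hB' : X.refl.Beta 0 := h.refl.beta_of_eq (by simpa using hB.1)
    have hd' := (nonF_cong hv hc).1 hd
    rw [hc.r hv] at hr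
    exact h.refl.false_of_beta_aux hk4 hxy hB' (by unfold NonF at hd' ⊢; simpa using hd') (by
          rw [refl_r, refl_e hv]; simpa using hr)

theorem Minimal.ne_of_four_le (h : X.Minimal) (hk4 : 4 ≤ X.k) : X.q 1 ≠ X.q (X.n + 1) := by
  intro hxy
  have hn := h.n_pos
  have hxy' : X.rev.q 1 = X.rev.q (X.rev.n + 1) := by simp [hxy]
  obtain ⟨j, hj⟩ := h.exists_nonB (i := X.n) hn le_rfl
  have key : ∀ j, ¬ X.rev.Alpha j := fun j ha =>
    (h.shift j).not_alpha_rev hxy (fun i hi => h.false_of_beta hk4 hxy (beta_shift.1 hi))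
      (by
        have := (alpha_shift (X := X.rev) (s := j) (j := 0)).2 (by simpa using ha)
        exact this)
  rcases h.rev.nonF_cases (j := j) (by rwa [rev_r_one, rev_q_two]) with ha | ha | hb
  · exact key _ ha
  · exact key _ ha
  · exact h.rev.false_of_beta hk4 hxy' hb

end Config

end EdgeColored

namespace EdgeColored

/-! ### From vertex lists to configurations. -/

variable {V K : Type*}

theorem Trail.getD {col : V → V → K} {α β : K} {a b : V} {l : List V} (h : Trail col α a l b β)
    (o : V) : l.getD 0 o = a ∧ l.getD (l.length - 1) o = b ∧
      (∀ i, i + 2 < l.length →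
        col (l.getD i o) (l.getD (i + 1) o) ≠ col (l.getD (i + 1) o) (l.getD (i + 2) o)) ∧
      (2 ≤ l.length → α ≠ col (l.getD 0 o) (l.getD 1 o)) ∧
      (2 ≤ l.length → col (l.getD (l.length - 2) o) (l.getD (l.length - 1) o) ≠ β) := by
  induction h with
  | single h => simp
  | @cons α β a b z l h t ih =>
    obtain ⟨h1, h2, h3, h4, h5⟩ := ih
    have hl : 0 < l.length := List.length_pos_of_ne_nil t.ne_nil
    refine ⟨by simp, ?_, ?_, ?_, ?_⟩
    · obtain ⟨m, hm⟩ : ∃ m, l.length = m + 1 := ⟨l.length - 1, by omega⟩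
      rw [hm] at h2
      simpa [hm] using h2
    · rintro (_ | i) hi
      · simp only [List.length_cons] at hi
        have := h4 (by omega)
        simp only [List.getD_cons_zero, zero_add, List.getD_cons_succ, h1] at this ⊢
        exact this
      · simp only [List.length_cons] at hi
        simpa using h3 i (by omega)
    · intro _
      rw [List.getD_cons_zero, List.getD_cons_succ, h1]
      exact h
    · intro _
      cases t with
      | single h' => simpa using h'
      | @cons _ _ _ b' _ l h' t' =>
        have hl' : 0 < l.length := List.length_pos_of_ne_nil t'.ne_nil
        obtain ⟨m, hm⟩ : ∃ m, l.length = m + 1 := ⟨l.length - 1, by omega⟩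
        have := h5 (by simp [hm])
        simpa [hm] using this

namespace Config

/-- The configuration given by the list of vertices of the path and that of the cycle. -/
def ofLists (col : V → V → K) (o : V) (L Z : List V) : Config V K where
  col := col
  n := L.length - 2
  k := Z.length
  v i := L.getD i o
  -- The value at `i = 0` is junk; path edges are numbered from 1.
  q i := col (L.getD (i - 1) o) (L.getD i o)
  c j := Z.getD (j % Z.length).toNat o

variable {col : V → V → K} {o : V} {L Z : List V}

theorem map_getD_range (l : List V) (o : V) : (List.range l.length).map (fun i => l.getD i o) = l := by
  apply List.ext_getElem
  · simp
  · intro i h1 h2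
    simp [List.getD_eq_getElem?_getD, h2]

theorem ofLists_verts (hL : 2 ≤ L.length) (hZ : 3 ≤ Z.length) :
    (ofLists col o L Z).verts = L ++ Z := by
  have e1 : seg (ofLists col o L Z).v 0 ((ofLists col o L Z).n + 1) = L := by
    conv_rhs => rw [← map_getD_range L o]
    simp [seg, run, ofLists, show L.length - 2 + 1 + 1 = L.length by omega]
  have e2 : arc (ofLists col o L Z).c 0 ((ofLists col o L Z).k - 1) = Z := by
    conv_rhs => rw [← map_getD_range Z o]
    simp only [arc, run, ofLists, show Z.length - 1 + 1 = Z.length by omega]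
    refine List.map_congr_left fun i hi => ?_
    have : i < Z.length := by simpa using hi
    congr 1
    rw [zero_add, Int.emod_eq_of_lt (by omega) (by omega)]
    rfl
  rw [verts, e1, e2]

theorem ofLists_valid (hs : ∀ a b, col a b = col b a) (hnd : (L ++ Z).Nodup)
    (hL : 2 ≤ L.length) (hZ : 3 ≤ Z.length)
    (hpc : ∀ i, i + 2 < L.length →
      col (L.getD i o) (L.getD (i + 1) o) ≠ col (L.getD (i + 1) o) (L.getD (i + 2) o))
    (hZpc : ∀ i, i + 2 < Z.length →
      col (Z.getD i o) (Z.getD (i + 1) o) ≠ col (Z.getD (i + 1) o) (Z.getD (i + 2) o))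
    (hZ1 : col (Z.getD (Z.length - 2) o) (Z.getD (Z.length - 1) o) ≠
      col (Z.getD (Z.length - 1) o) (Z.getD 0 o))
    (hZ2 : col (Z.getD (Z.length - 1) o) (Z.getD 0 o) ≠ col (Z.getD 0 o) (Z.getD 1 o))
    (hl : ∀ z ∈ Z, col (L.getD 0 o) z = col (L.getD 0 o) (L.getD 1 o))
    (hr : ∀ z ∈ Z, col (L.getD (L.length - 1) o) z =
      col (L.getD (L.length - 2) o) (L.getD (L.length - 1) o)) :
    (ofLists col o L Z).Valid := by
  have hmem : ∀ j : ℤ, (ofLists col o L Z).c j ∈ Z := by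
    intro j
    have h0 := Int.emod_nonneg j (show (Z.length : ℤ) ≠ 0 by omega)
    have h1 := Int.emod_lt_of_pos j (show (0 : ℤ) < Z.length by omega)
    simp only [ofLists]
    rw [List.getD_eq_getElem _ _ (by omega)]
    exact List.getElem_mem _
  have hvmem : ∀ i, i < L.length → L.getD i o ∈ L := by
    intro i hi
    rw [List.getD_eq_getElem _ _ hi]
    exact List.getElem_mem _
  rw [List.nodup_append] at hnd
  obtain ⟨hn1, hn2, hn3⟩ := hnd
  refine
    { symm := hs
      three_le := hZ
      injv := ?_
      perc := ?_
      injc := ?_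
      disj := ?_
      hq := ?_
      qne := ?_
      ene := ?_
      left := fun j => hl _ (hmem j)
      right := fun j => ?_ }
  · intro i j hi hj hij
    simp only [ofLists] at hi hj hij
    rw [List.getD_eq_getElem _ _ (by omega), List.getD_eq_getElem _ _ (by omega)] at hij
    exact (List.Nodup.getElem_inj_iff hn1).1 hij
  · intro i
    simp [ofLists]
  · intro i j hij
    simp only [ofLists] at hij ⊢
    have h0 := Int.emod_nonneg i (show (Z.length : ℤ) ≠ 0 by omega)
    have h1 := Int.emod_lt_of_pos i (show (0 : ℤ) < Z.length by omega)
    have h2 := Int.emod_nonneg j (show (Z.length : ℤ) ≠ 0 by omega)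
    have h3 := Int.emod_lt_of_pos j (show (0 : ℤ) < Z.length by omega)
    rw [List.getD_eq_getElem _ _ (by omega), List.getD_eq_getElem _ _ (by omega)] at hij
    have := (List.Nodup.getElem_inj_iff hn2).1 hij
    exact Int.ModEq.dvd (show j % Z.length = i % Z.length by omega)
  · intro i j hi
    simp only [ofLists] at hi
    exact hn3 _ (hvmem i (by omega)) _ (hmem j)
  · intro i hi
    rfl
  · intro i h1 hi
    simp only [ofLists] at hi
    obtain ⟨i, rfl⟩ : ∃ l, i = l + 1 := ⟨i - 1, by omega⟩
    exact hpc i (by omega)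
  · intro i
    have h0 := Int.emod_nonneg i (show (Z.length : ℤ) ≠ 0 by omega)
    have h1 := Int.emod_lt_of_pos i (show (0 : ℤ) < Z.length by omega)
    simp only [e, ofLists, add_assoc]
    obtain ⟨m, hm⟩ := Int.eq_ofNat_of_zero_le h0
    have hc : ∀ a : ℕ, (i + a) % (Z.length : ℤ) = (m + a : ℕ) % (Z.length : ℤ) := by
      intro a
      rw [Int.add_emod, hm]; simp
    have c1 := hc 1
    have c2 := hc 2
    rw [hm] at h1
    have h1' : m < Z.length := by exact_mod_cast h1
    norm_num at c1 c2
    rw [hm, show (1 : ℤ) + 1 = 2 by norm_num, c1, c2]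
    rcases lt_trichotomy (m + 2) Z.length with hlt | heq | hgt
    · rw [Int.emod_eq_of_lt (by omega) (by omega), Int.emod_eq_of_lt (by omega) (by omega)]
      exact hZpc m hlt
    · rw [Int.emod_eq_of_lt (by omega) (by omega), show ((m : ℤ) + 2) = Z.length by omega,
        Int.emod_self]
      convert hZ1 using 2 <;> congr 1 <;> omega
    · rw [show ((m : ℤ) + 1) = Z.length by omega, show ((m : ℤ) + 2) = 1 + Z.length by omega,
        Int.emod_self, Int.add_emod_right, Int.emod_eq_of_lt (by omega) (by omega)]
      convert hZ2 using 2 <;> congr 1 <;> omega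
  · have := hr _ (hmem j)
    simpa [ofLists, r, show L.length - 2 + 1 = L.length - 1 by omega,
      show L.length - 1 - 1 = L.length - 2 by omega] using this

/-- `hm` concerns only the length of `Z`, so that the lemma can also be used when longer cycles are
reduced to triangles. -/
theorem hamPath_of_lists {x y : K} {u w : V} (hm : ∀ Y : Config V K, Y.k = Z.length → ¬ Y.Losing)
    (hs : ∀ a b, col a b = col b a) (hnd : (L ++ Z).Nodup)
    (hL : 2 ≤ L.length) (hZ : 3 ≤ Z.length)
    (ht : ∀ ξ η, ξ ≠ x → η ≠ y → Trail col ξ u L w η)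
    (hZpc : ∀ i, i + 2 < Z.length →
      col (Z.getD i u) (Z.getD (i + 1) u) ≠ col (Z.getD (i + 1) u) (Z.getD (i + 2) u))
    (hZ1 : col (Z.getD (Z.length - 2) u) (Z.getD (Z.length - 1) u) ≠
      col (Z.getD (Z.length - 1) u) (Z.getD 0 u))
    (hZ2 : col (Z.getD (Z.length - 1) u) (Z.getD 0 u) ≠ col (Z.getD 0 u) (Z.getD 1 u))
    (hl : ∀ z ∈ Z, col u z = x) (hr : ∀ z ∈ Z, col w z = y) : HamPath col (L ++ Z) u w x y := by
  have hex : ∀ x : K, ∃ ξ, ξ ≠ x := by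
    intro x
    by_contra! hcon
    exact hZ2 ((hcon _).trans (hcon _).symm)
  obtain ⟨ξ, hξ⟩ := hex x
  obtain ⟨η, hη⟩ := hex y
  obtain ⟨h1, h2, h3, -, -⟩ := (ht ξ η hξ hη).getD u
  -- `ht` allows every boundary color but `x`; a first edge of another color would clash with itself
  -- taken as boundary color.
  have hx : col (L.getD 0 u) (L.getD 1 u) = x := by
    by_contra hcon
    exact ((ht _ η hcon hη).getD u).2.2.2.1 hL rfl
  have hy : col (L.getD (L.length - 2) u) (L.getD (L.length - 1) u) = y := by
    by_contra hcon
    exact ((ht ξ _ hξ hcon).getD u).2.2.2.2 hL rfl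
  have hv := ofLists_valid hs hnd hL hZ h3 hZpc hZ1 hZ2
    (fun z hz => by rw [hx, h1]; exact hl z hz) (fun z hz => by rw [hy, h2]; exact hr z hz)
  by_contra hcon
  refine hm (ofLists col u L Z) rfl ⟨hv, fun hwin => hcon ?_⟩
  rw [Win, ofLists_verts hL hZ] at hwin
  convert hwin using 1
  · rfl
  · exact h1.symm
  · rw [← h2]
    simp [ofLists, show L.length - 2 + 1 = L.length - 1 by omega]
  · exact hx.symm
  · rw [← hy]
    simp [ofLists, show L.length - 2 + 1 = L.length - 1 by omega,
      show L.length - 1 - 1 = L.length - 2 by omega]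

end Config

end EdgeColored

namespace EdgeColored

/-! ### Different end colors, and reduction of longer cycles to triangles. -/

variable {V K : Type*}

namespace Config

variable {X : Config V K}

theorem Cong.refl_neg {a b : ℤ} : X.refl.Cong (-a) (-b) ↔ X.Cong a b := by
  constructor <;> rintro ⟨z, hz⟩ <;> exact ⟨-z, by simp at hz ⊢; linarith⟩

theorem Cong.shift_iff {a b s : ℤ} : (X.shift s).Cong a b ↔ X.Cong (a + s) (b + s) := by
  constructor <;> rintro ⟨z, hz⟩ <;> exact ⟨z, by simp at hz ⊢; linarith⟩

theorem arc_succ' (c : ℤ → V) (s : ℤ) (m : ℕ) : arc c s (m + 1) = c s :: arc c (s + 1) m := by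
  rw [arc, run_succ']
  simp [arc, add_comm, add_left_comm]

theorem seg_succ' (v : ℕ → V) (s : ℕ) (m : ℕ) : seg v s (m + 1) = v s :: seg v (s + 1) m := by
  rw [seg, run_succ']
  simp [seg, add_comm, add_left_comm]

theorem nodup_verts (h : X.Valid) : X.verts.Nodup := by
  have hk := h.three_le
  rw [verts, List.nodup_append]
  refine ⟨?_, nodup_arc h _ (by omega), ?_⟩
  · rw [seg, run]
    refine List.Nodup.map_on ?_ List.nodup_range
    intro a ha b hb hab
    simp at ha hb
    have := h.injv _ _ (by omega) (by omega) hab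
    omega
  · intro a ha b hb
    obtain ⟨t, ht, rfl⟩ := mem_run.1 ha
    obtain ⟨s, -, rfl⟩ := mem_run.1 hb
    exact h.disj _ _ (by omega)

/-- The detours are `v 0, c (t + 1), …, c k = c 0, v 1` and `v n, c t, …, c 1, v (n + 1)`.
`Losing.plus` at both ends gives `e 1 = q 1` and `e (t + 1) = q (n + 1)`; as the end colors differ,
only one-vertex arcs can fail. -/
theorem Minimal.plus_plus_zero (h : X.Minimal) (hxy : X.q 1 ≠ X.q (X.n + 1)) {t : ℤ}
    (hj : X.r 1 0 ≠ X.q 2) (hj' : X.r 1 0 ≠ X.e (-1)) (ht : X.r X.n t ≠ X.q X.n)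
    (ht' : X.r X.n t ≠ X.e (t - 1)) :
    (X.Cong t (-1) ∧ X.r 1 0 = X.q 1) ∨ (X.Cong t 1 ∧ X.r X.n t = X.q (X.n + 1)) := by
  have hv := h.toValid
  have hk := h.three_le
  have hn := h.two_le
  obtain ⟨t, hc, ht0, htk⟩ := exists_rep hv t 1
  have hee := hc.e hv (-1)
  simp only [← sub_eq_add_neg] at hee
  rw [← hc.r hv] at ht ht'
  rw [← hee] at ht'
  suffices (t = X.k - 1 ∧ X.r 1 0 = X.q 1) ∨ (t = 1 ∧ X.r X.n t = X.q (X.n + 1)) by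
    rw [← hc.r hv]
    refine this.imp (And.imp_left fun hh => ?_) (And.imp_left fun hh => ?_)
    · exact hc.symm.trans ⟨1, by rw [hh]; ring⟩
    · exact hc.symm.trans ⟨0, by rw [hh]; ring⟩
  clear hc hee
  have p0 := h.plus (by omega) 0
  have pt := h.rev.plus (by simp; omega) t
  rw [rev_r_one, rev_q_two, rev_q_one, rev_e, rev_e] at pt
  norm_num at p0
  have g0 : X.r X.n X.k = X.r X.n 0 := by rw [← perr hv X.n 0, zero_add]
  have g2 : X.r 1 X.k = X.r 1 0 := by rw [← perr hv 1 0, zero_add]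
  have g4 : X.e (X.k - 1) = X.e (-1) := by rw [← pere hv (-1)]; ring_nf
  have g5 : X.e (X.k + 1) = X.e 1 := by rw [← pere hv 1]; ring_nf
  have g6 : X.r X.n (X.k + 1) = X.r X.n 1 := by rw [← perr hv X.n 1, add_comm]
  have hlA := h.left
  have hr := h.right
  by_contra! hcon
  rcases eq_or_ne t X.k with rfl | htk'
  · grind
  refine h.two_asc_desc 0 X.n (by omega) le_rfl (t + 1) X.k (by omega) (by omega) ?_ ?_ ?_ ?_ ?_ ?_
    ?_ ?_ ?_ ?_ ?_ <;> intros <;> norm_num at * <;> grind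

theorem Minimal.plus_plus (h : X.Minimal) (hxy : X.q 1 ≠ X.q (X.n + 1)) {j t : ℤ}
    (hj : X.r 1 j ≠ X.q 2) (hj' : X.r 1 j ≠ X.e (j - 1)) (ht : X.r X.n t ≠ X.q X.n)
    (ht' : X.r X.n t ≠ X.e (t - 1)) :
    (X.Cong t (j - 1) ∧ X.r 1 j = X.q 1) ∨ (X.Cong t (j + 1) ∧ X.r X.n t = X.q (X.n + 1)) := by
  have := (h.shift j).plus_plus_zero (t := t - j) hxy (by simpa using hj)
    (by simpa [neg_add_eq_sub] using hj') (by simpa using ht)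
    (by
      rw [shift_r, shift_e, show t - j - 1 + j = t - 1 by ring, sub_add_cancel]
      exact ht')
  simpa [Cong.shift_iff, add_comm, sub_eq_add_neg] using this

theorem Minimal.minus_minus (h : X.Minimal) (hxy : X.q 1 ≠ X.q (X.n + 1)) {j t : ℤ}
    (hj : X.r 1 j ≠ X.q 2) (hj' : X.r 1 j ≠ X.e j) (ht : X.r X.n t ≠ X.q X.n)
    (ht' : X.r X.n t ≠ X.e t) :
    (X.Cong t (j + 1) ∧ X.r 1 j = X.q 1) ∨ (X.Cong t (j - 1) ∧ X.r X.n t = X.q (X.n + 1)) := by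
  have hv := h.toValid
  have := h.refl.plus_plus (t := -t) (j := -j) hxy (by simpa using hj)
    (by rw [refl_r, refl_e hv]; simpa using hj') (by simpa using ht)
    (by rw [refl_n, refl_r, refl_e hv]; simpa using ht')
  rw [show -j - 1 = -(j + 1) by ring, show -j + 1 = -(j - 1) by ring] at this
  rw [Cong.refl_neg, Cong.refl_neg] at this
  simpa using this

theorem cong_add {a b s : ℤ} : X.Cong (a + s) (b + s) ↔ X.Cong a b := by
  constructor <;> rintro ⟨z, hz⟩ <;> exact ⟨z, by linarith⟩

theorem Minimal.not_alpha_aux (h : X.Minimal) (hxy : X.q 1 ≠ X.q (X.n + 1)) {a b : ℤ}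
    (ha : X.Alpha a) (hb : X.rev.Alpha b) : False := by
  have na := h.alpha_ne ha
  have nb := h.rev.alpha_ne hb
  obtain ⟨a1, a2, a3, a4, a5⟩ := ha
  obtain ⟨b1, b2, b3, b4, b5⟩ := hb
  have ea := h.ene (a - 1)
  have eb := h.ene (b - 1)
  rw [sub_add_cancel] at ea eb
  simp only [rev_r_one, rev_q_one, rev_q_two, rev_e] at *
  rcases h.plus_plus hxy a1 (by grind) b1 (by grind) with ⟨-, c⟩ | ⟨-, c⟩
  · exact na c
  · exact nb c

/-- The kind `Alpha` gives non-forward edges at both `c a` and `c (a + 1)`. Against a vertex `c b`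
of kind `Beta` for the other end, they force `b` to be congruent to `a + 1` and to `a`. -/
theorem Minimal.not_alpha (h : X.Minimal) (hxy : X.q 1 ≠ X.q (X.n + 1)) {a : ℤ} :
    ¬ X.Alpha a := by
  intro ha
  have hn := h.n_pos
  have hk := h.three_le
  obtain ⟨b, hb⟩ := h.exists_nonB (i := X.n) hn le_rfl
  rcases h.rev.nonF_cases (j := b) (by rwa [rev_r_one, rev_q_two]) with hb | hb | hb
  · exact h.not_alpha_aux hxy ha hb
  · exact h.not_alpha_aux hxy ha hb
  obtain ⟨b1, b2, b3, b4⟩ := hb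
  have na := h.alpha_ne ha
  have na' := h.alpha_ne' (j := a + 1) (by simpa using ha)
  obtain ⟨a1, a2, a3, a4, a5⟩ := ha
  have ea := h.ene (a - 1)
  have ea1 := h.ene a
  have eb := h.ene b
  have eb1 := h.ene (b - 2)
  rw [show b - 2 + 1 = b - 1 by ring] at eb1
  rw [sub_add_cancel] at ea
  simp only [rev_r_one, rev_q_one, rev_e] at *
  have hq := h.qne X.n hn le_rfl
  rcases h.plus_plus hxy a1 (by grind) (t := b) (by grind) (by grind) with ⟨-, c⟩ | ⟨c, -⟩
  · exact na c
  rcases h.minus_minus hxy (j := a + 1) (by grind) (by grind) (t := b) (by grind) (by grind) with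
    ⟨-, c'⟩ | ⟨c', -⟩
  · exact na' c'
  · rw [add_sub_cancel_right] at c'
    exact not_cong (by omega) (by omega) (c'.symm.trans c)

theorem Minimal.beta_beta (h : X.Minimal) (hxy : X.q 1 ≠ X.q (X.n + 1)) {a b : ℤ}
    (ha : X.r 1 a = X.q 1) (hb : X.r X.n b = X.q (X.n + 1)) :
    X.Cong b (a - 1) ∨ X.Cong b (a + 1) := by
  have hn := h.n_pos
  obtain ⟨a1, a2, a3, a4⟩ := h.beta_of_eq ha
  obtain ⟨b1, b2, b3, b4⟩ := h.rev.beta_of_eq (by rwa [rev_r_one, rev_q_one])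
  have hq := h.qne X.n hn le_rfl
  have hq1 := h.qne 1 le_rfl hn
  have ea := h.ene (a - 2)
  have eb := h.ene (b - 2)
  simp only [rev_r_one, rev_q_one, rev_e] at *
  rw [show a - 2 + 1 = a - 1 by ring] at ea
  rw [show b - 2 + 1 = b - 1 by ring] at eb
  rcases h.plus_plus hxy (j := a) (by grind) (by grind) (t := b) (by grind) (by grind) with
    ⟨c, -⟩ | ⟨c, -⟩
  · exact .inl c
  · exact .inr c

theorem Minimal.eq_end_of_nonF (h : X.Minimal) (hxy : X.q 1 ≠ X.q (X.n + 1)) {a : ℤ}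
    (ha : X.r 1 a ≠ X.q 2) : X.r 1 a = X.q 1 := by
  rcases h.nonF_cases ha with ha | ha | ha
  · exact absurd ha (h.not_alpha hxy)
  · exact absurd ha (h.not_alpha hxy)
  · exact ha.1

theorem Minimal.false_of_adjacent (h : X.Minimal) (hk4 : 4 ≤ X.k)
    (h3 : ∀ Y : Config V K, Y.k = 3 → ¬ Y.Losing) (hxy : X.q 1 ≠ X.q (X.n + 1))
    (ha : X.r 1 0 = X.q 1) (hb : X.r X.n 1 = X.q (X.n + 1)) : False := by
  have hv := h.toValid
  have hn := h.two_le
  obtain ⟨a1, a2, a3, a4⟩ := h.beta_of_eq ha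
  obtain ⟨b1, b2, b3, b4⟩ := h.rev.beta_of_eq (j := 1) (by rwa [rev_r_one, rev_q_one])
  simp only [rev_r_one, rev_q_one, rev_e] at *
  have e0 := h.ene 0
  have e1 := h.ene 1
  have em1 := h.ene (-1)
  have em2 := h.ene (-2)
  have em3 := h.ene (-3)
  have e2 := h.ene 2
  norm_num at a2 a3 b2 b3 e0 e1 em1 em2 em3 e2
  have hq := h.qne X.n (by omega) le_rfl
  have hq1 := h.qne 1 le_rfl (by omega)
  norm_num at hq1
  have hlA := h.left
  have hr := h.right
  have hrow : ∀ j, ¬ X.Cong j 0 → X.r 1 j = X.q 2 := by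
    intro j hj
    by_contra hj'
    have hj2 := h.eq_end_of_nonF hxy hj'
    rcases h.beta_beta hxy hj2 hb with hc | hc
    · have c2 : X.Cong j 2 := by
        have := cong_add (X := X) (a := 1) (b := j - 1) (s := 1)
        norm_num at this
        exact (this.2 hc).symm
      have := (h.beta_of_eq hj2).2.2.1
      have c3 := c2.e hv (-2)
      rw [← sub_eq_add_neg] at c3
      norm_num at c3
      grind
    · have := cong_add (X := X) (a := 0) (b := j) (s := 1)
      norm_num at this
      exact hj (this.1 hc).symm
  have r1 : X.r 1 1 = X.q 2 := hrow 1 (not_cong' (by omega) (by omega))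
  have g0 : X.r 1 X.k = X.r 1 0 := by rw [← perr hv 1 0, zero_add]
  have g1 : X.r 1 (X.k + 1) = X.r 1 1 := by rw [← perr hv 1 1, add_comm]
  have g2 : X.r 2 (X.k - 1) = X.r 2 (-1) := by rw [← perr hv 2 (-1)]; ring_nf
  have g3 : X.r 2 (X.k + 1) = X.r 2 1 := by rw [← perr hv 2 1]; ring_nf
  have g4 : X.e (X.k - 1) = X.e (-1) := by rw [← pere hv (-1)]; ring_nf
  have g5 : X.e (X.k + 1) = X.e 1 := by rw [← pere hv 1]; ring_nf
  have g8 : X.r X.n (X.k + 1) = X.r X.n 1 := by rw [← perr hv X.n 1, add_comm]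
  have g6 : X.e (X.k - 2) = X.e (-2) := by rw [← pere hv (-2)]; ring_nf
  have g7 : X.e (X.k - 3) = X.e (-3) := by rw [← pere hv (-3)]; ring_nf
  -- For `k = 4` the edges `e 2` and `e (-2)` coincide but carry different end colors.
  have hk5 : 5 ≤ X.k := by
    rcases Nat.lt_or_ge 4 X.k with hk | hk
    · exact hk
    · have : X.k = 4 := by omega
      rw [this] at g6
      norm_num at g6
      grind
  obtain ⟨d, hd₀⟩ := h.exists_nonF (i := 2) (by omega) hn
  have hd : X.NonF 2 d := fun _ => hd₀
  have hR : X.r 2 (-1) = X.e (-1) ∧ X.r 2 (-1) ≠ X.q 3 := by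
    rcases a4 d hd with ⟨hc, hq⟩ | ⟨hc, hq⟩
    · rw [hc.r hv] at hq hd₀
      norm_num at hq hd₀
      exact ⟨hq, hd₀⟩
    exfalso
    rw [hc.r hv] at hq hd₀
    norm_num at hq hd₀
    have t1 : X.q 2 = X.e 0 := by
      by_contra hcon
      refine h.two_asc_asc 0 1 (by omega) (by omega) 2 X.k (by omega) (by omega) ?_ ?_ ?_ ?_ ?_ ?_
        ?_ ?_ ?_ ?_ ?_ <;> intros <;> norm_num at * <;> grind
    have t3 : X.e 3 = X.q 1 := by
      have r2 : X.r 1 2 = X.q 2 := hrow 2 (not_cong' (by omega) (by omega))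
      have r2' : X.r 1 (2 + X.k) = X.q 2 := by rw [perr hv]; exact r2
      by_contra hcon
      refine h.two_asc_desc 0 1 (by omega) (by omega) 3 X.k (by omega) (by omega) ?_ ?_ ?_ ?_ ?_ ?_
        ?_ ?_ ?_ ?_ ?_ <;> intros <;> norm_num at * <;> grind
    have r3 : X.r 1 3 = X.q 2 := hrow 3 (not_cong' (by omega) (by omega))
    have e3 := h.ene 3
    norm_num at e3
    refine h.two_asc_desc 0 1 (by omega) (by omega) 4 X.k (by omega) (by omega) ?_ ?_ ?_ ?_ ?_ ?_
        ?_ ?_ ?_ ?_ ?_ <;> intros <;> norm_num at * <;> grind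
  obtain ⟨hR1, hR2⟩ := hR
  have r9 : X.r 1 (X.k - 1) = X.q 2 := hrow _ (not_cong' (by omega) (by omega))
  have q2 : X.q 2 = X.q (X.n + 1) := by
    by_contra hh
    refine h.two_desc_asc 0 1 (by omega) (by omega) 0 (X.k - 2) (by omega) (by omega) ?_ ?_ ?_ ?_ ?_
      ?_ ?_ ?_ ?_ ?_ ?_ <;> intros <;> (try ring_nf at *) <;> grind
  have E3 : X.e 3 = X.q 1 := by
    by_contra hh
    refine h.two_asc_asc 0 X.n (by omega) le_rfl 3 X.k (by omega) (by omega) ?_ ?_ ?_ ?_ ?_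
      ?_ ?_ ?_ ?_ ?_ ?_ <;> intros <;> norm_num at * <;> grind
  have full : (X.c 1 :: X.c 0 :: X.iv 2 (X.k - 1)).Perm (arc X.c 0 (X.k - 1)) := by
    rw [iv, show ((X.k : ℤ) - 1 - 2).toNat = X.k - 3 by omega,
      show X.k - 1 = X.k - 3 + 1 + 1 by omega, arc_succ', arc_succ']
    exact List.Perm.swap _ _ _
  have e01 : X.col (X.c 1) (X.c 0) = X.e 0 := h.symm _ _
  have c1 : ∀ ξ, ξ ≠ X.e 2 → Trail X.col ξ (X.c 2) (X.iv 2 (X.k - 1)) (X.c (X.k - 1)) (X.r 2 (X.k - 1)) := by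
    intro ξ hξ
    refine trail_asc hv (by omega) (by omega) (fun _ => hξ) (fun _ => ?_)
    rw [show (X.k : ℤ) - 1 - 1 = X.k - 2 by ring]
    grind
  -- Otherwise the detour `v 1, c 1, c 0, c 2, …, c (k - 1), v 2` uses the chord.
  have hx2 : X.col (X.c 0) (X.c 2) ≠ X.q 1 := by
    intro hh
    refine h.one (i := 1) (a := 1) (a' := X.k - 1) (by omega) (fun _ => by grind)
      (.cons (b := X.c 0) (by grind) (.cons (b := X.c 2) (by grind) (c1 _ (by grind))))
      (fun _ => by grind) full
  -- Otherwise `v 0, c 1, v 1, c 0, c 2, …, c (k - 1), v 2` works. So the triangle `c 0, c 1, c 2`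
  -- is properly colored.
  have hy2 : X.col (X.c 0) (X.c 2) = X.q (X.n + 1) := by
    by_contra hh
    refine h.two (i := 0) (j := 1) (a := 1) (a' := 1) (b := 0) (b' := X.k - 1) (A := [X.c 1])
      (B := X.c 0 :: X.iv 2 (X.k - 1)) (by omega) (by omega)
      (by omega) (.single (by grind)) (by grind) (by omega) (by omega)
      (.cons (b := X.c 2) (by grind) (c1 _ (by grind)))
      (fun _ => by grind) full
  have cm : ∀ j, X.c (X.k + j) = X.c j := fun j => by rw [add_comm]; exact h.perc j
  -- The rest of the cycle is absorbed between `v 1` and `v 2`; the longer path keeps its character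
  -- and leaves just the triangle.
  have tr : ∀ ξ η, ξ ≠ X.q 1 → η ≠ X.q (X.n + 1) → Trail X.col ξ (X.v 0)
      (X.v 0 :: X.v 1 :: (X.iv 3 (X.k - 1) ++ seg X.v 2 (X.n + 1 - 2))) (X.v (X.n + 1)) η := by
    intro ξ η hξ hη
    have r3 : X.r 1 3 = X.q 2 := hrow 3 (not_cong' (by omega) (by omega))
    have q1 : X.q 1 = X.col (X.v 0) (X.v 1) := h.hq 0 (by omega)
    have t1 : Trail X.col (X.q 1) (X.v 1) [X.v 1] (X.v 1) (X.r 1 3) := .single (by grind)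
    have t2 : Trail X.col (X.r 1 3) (X.c 3) (X.iv 3 (X.k - 1)) (X.c (X.k - 1)) (X.r 2 (X.k - 1)) := by
      refine trail_asc hv (by omega) (by omega) (fun _ => by grind) (fun _ => ?_)
      rw [show (X.k : ℤ) - 1 - 1 = X.k - 2 by ring]
      grind
    have t3 := trail_seg hv (i := 2) (j := X.n + 1) (α := X.r 2 (X.k - 1)) (β := η) (by omega) le_rfl
      (by omega) (fun _ => by grind) (fun _ => hη.symm)
    exact .cons (b := X.v 1) (by rw [← q1]; exact hξ) (q1 ▸ t1.append (t2.glue t3 (h.symm _ _)))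
  have hp : (X.v 0 :: X.v 1 :: (X.iv 3 (X.k - 1) ++ seg X.v 2 (X.n + 1 - 2)) ++
      [X.c 0, X.c 1, X.c 2]).Perm X.verts := by
    have s1 : seg X.v 0 (X.n + 1) = X.v 0 :: X.v 1 :: seg X.v 2 (X.n + 1 - 2) := by
      rw [show X.n + 1 = X.n + 1 - 2 + 1 + 1 by omega, seg_succ', seg_succ']; rfl
    have s2 : arc X.c 0 (X.k - 1) = X.c 0 :: X.c 1 :: X.c 2 :: X.iv 3 (X.k - 1) := by
      rw [iv, show ((X.k : ℤ) - 1 - 3).toNat = X.k - 4 by omega,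
        show X.k - 1 = X.k - 4 + 1 + 1 + 1 by omega, arc_succ', arc_succ', arc_succ']
      rfl
    classical
    rw [verts, s1, s2, List.perm_iff_count]
    intro a
    simp only [List.count_append, List.count_cons, List.count_nil]
    omega
  refine h.no ?_
  have := hamPath_of_lists (x := X.q 1) (y := X.q (X.n + 1)) h3 h.symm
    (hp.nodup_iff.2 (nodup_verts hv)) (by simp) (by simp) tr ?_ ?_ ?_ ?_ ?_
  · obtain ⟨L, hL, ht⟩ := this
    exact ⟨L, hL.trans hp, ht⟩
  · intro i hi
    obtain rfl : i = 0 := by simp at hi; omega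
    exact e0
  · show X.e 1 ≠ X.col (X.c 2) (X.c 0)
    rw [h.symm, hy2]; grind
  · show X.col (X.c 2) (X.c 0) ≠ X.e 0
    rw [h.symm, hy2]; grind
  · intro z hz
    simp at hz
    rcases hz with rfl | rfl | rfl <;> exact hlA _
  · intro z hz
    simp at hz
    rcases hz with rfl | rfl | rfl <;> exact hr _

theorem not_minimal_of_four_le (hk4 : 4 ≤ X.k) (h3 : ∀ Y : Config V K, Y.k = 3 → ¬ Y.Losing) :
    ¬ X.Minimal := by
  intro h
  have hn := h.n_pos
  have hv := h.toValid
  have hxy := h.ne_of_four_le hk4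
  obtain ⟨a, ha⟩ := h.exists_nonF le_rfl hn
  obtain ⟨b, hb⟩ := h.exists_nonB hn le_rfl
  have ha' := h.eq_end_of_nonF hxy ha
  have hb' := h.rev.eq_end_of_nonF (by simpa using hxy.symm) (a := b) (by simpa using hb)
  rw [rev_r_one, rev_q_one] at hb'
  rcases h.beta_beta hxy ha' hb' with hc | hc
  · refine (h.shift a).refl.false_of_adjacent hk4 h3 hxy (by simpa using ha') ?_
    rw [hc.r hv] at hb'
    simpa [neg_add_eq_sub] using hb'
  · refine (h.shift a).false_of_adjacent hk4 h3 hxy (by simpa using ha') ?_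
    rw [hc.r hv] at hb'
    simpa [add_comm] using hb'

/-! ### Triangles: special vertices and transfer of colors between consecutive rows. -/

theorem per3_r (h : X.Valid) (hk : X.k = 3) (i : ℕ) (j : ℤ) : X.r i (j + 3) = X.r i j := by
  have := perr h i j; rwa [hk] at this

theorem per3_e (h : X.Valid) (hk : X.k = 3) (j : ℤ) : X.e (j + 3) = X.e j := by
  have := pere h j; rwa [hk] at this

theorem per3_c (h : X.Valid) (hk : X.k = 3) (j : ℤ) : X.c (j + 3) = X.c j := by
  have := h.perc j; rwa [hk] at this

/-- `Alpha` would give color `q 1` to `e (j - 1)` and `e (j + 1)`, which are adjacent edges of a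
triangle. -/
theorem Minimal.eq_end_three (h : X.Minimal) (hk : X.k = 3) {j : ℤ} (hj : X.r 1 j ≠ X.q 2) :
    X.r 1 j = X.q 1 ∧ X.e (j + 1) = X.q 1 := by
  have hv := h.toValid
  have hα : ∀ j, ¬ X.Alpha j := by
    intro j ⟨h1, h2, h3, h4, h5⟩
    have e1 := h.ene (j + 1)
    have e2 := per3_e hv hk (j - 1)
    ring_nf at *
    grind
  rcases h.nonF_cases hj with ha | ha | ha
  · exact absurd ha (hα _)
  · exact absurd ha (hα _)
  · exact ⟨ha.1, ha.2.1⟩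

theorem perm_three (hk : X.k = 3) : [X.c 2, X.c 0, X.c 1].Perm (arc X.c 0 (X.k - 1)) := by
  rw [hk]
  exact (List.Perm.swap _ _ _).trans ((List.Perm.swap _ _ _).cons _)

theorem col_two_zero (h : X.Valid) (hk : X.k = 3) : X.col (X.c 2) (X.c 0) = X.e 2 := by
  rw [e, ← per3_c h hk 0]; rfl

/-- A vertex `c p` of a triangle which is joined to `v 1` by an edge of color `q 1`. -/
structure Special (X : Config V K) (p : ℤ) : Prop extends X.Minimal where
  three : X.k = 3
  r0 : X.r 1 p = X.q 1
  r1 : X.r 1 (p + 1) = X.q 2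
  r2 : X.r 1 (p + 2) = X.q 2
  e1 : X.e (p + 1) = X.q 1

theorem Minimal.exists_special (h : X.Minimal) (hk : X.k = 3) : ∃ p, X.Special p := by
  have hv := h.toValid
  obtain ⟨j, hj⟩ := h.exists_nonF le_rfl h.n_pos
  obtain ⟨hj1, hj2⟩ := h.eq_end_three hk hj
  refine ⟨j, h, hk, hj1, ?_, ?_, hj2⟩
  · by_contra hh
    have := (h.eq_end_three hk hh).2
    exact h.ene (j + 1) (hj2.trans this.symm)
  · by_contra hh
    have := (h.eq_end_three hk hh).2
    have h3 := h.ene j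
    rw [add_assoc, show (2 : ℤ) + 1 = 3 by norm_num, per3_e hv hk] at this
    exact h3 (this.trans hj2.symm)

theorem Special.shift {p : ℤ} (h : X.Special p) (s : ℤ) : (X.shift s).Special (p - s) := by
  refine ⟨h.toMinimal.shift s, h.three, ?_, ?_, ?_, ?_⟩
  · simpa using h.r0
  · rw [shift_r, show p - s + 1 + s = p + 1 by ring]; exact h.r1
  · rw [shift_r, show p - s + 2 + s = p + 2 by ring]; exact h.r2
  · rw [shift_e, show p - s + 1 + s = p + 1 by ring]; exact h.e1

theorem Special.refl {p : ℤ} (h : X.Special p) : X.refl.Special (-p) := by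
  have hv := h.toValid
  refine ⟨h.toMinimal.refl, h.three, ?_, ?_, ?_, ?_⟩
  · simpa using h.r0
  · rw [refl_r, ← per3_r hv h.three, show -(-p + 1) + 3 = p + 2 by ring]; exact h.r2
  · rw [refl_r, ← per3_r hv h.three, show -(-p + 2) + 3 = p + 1 by ring]; exact h.r1
  · rw [refl_e hv, ← pere hv, h.three, refl_q, ← h.e1]; congr 1; push_cast; ring

/-- Otherwise `v 0, c 2, c 0, v 1, …, v i, c 1, v (i + 1)` works. -/
theorem Special.same_zero (h : X.Special 0) {i : ℕ} (hi : 1 ≤ i) (hin : i ≤ X.n)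
    (hB : X.r i 1 ≠ X.q i) (hF : X.NonF (i + 1) 1) : X.r i 1 = X.r (i + 1) 1 := by
  obtain ⟨hm, hk, h0, h1, h2, h3⟩ := id h
  norm_num at h1 h2 h3
  have hv := h.toValid
  by_contra hne
  have q1 := h.qne 1 le_rfl h.n_pos
  have e1 := h.ene 1
  have l0 := h.left 2
  have c20 := col_two_zero hv hk
  norm_num at e1 q1
  refine h.two (i := 0) (j := i) (a := 2) (a' := 0) (b := 1) (b' := 1) (A := [X.c 2, X.c 0])
    (B := [X.c 1]) (by omega) hin (by omega) (.cons (b := X.c 0) (by grind) (.single (by grind)))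
    (by intro hi1; obtain rfl : i = 1 := by omega
        grind) (fun _ => by grind) (fun _ => hB) (.single hne) hF (perm_three hk)

/-- If `r i 2 ≠ e 2`, the detour is `v i, c 2, c 0, c 1, v (i + 1)`. If they agree, `v 0, c 2, v i,
…, v 1, c 0, c 1, v (i + 1)` is used instead. -/
theorem Special.cross_zero (h : X.Special 0) {i : ℕ} (hi : 1 ≤ i) (hin : i ≤ X.n)
    (hB : X.r i 2 ≠ X.q i) (hF : X.NonF (i + 1) 1) : X.r (i + 1) 1 = X.e 0 := by
  obtain ⟨hm, hk, h0, h1, h2, h3⟩ := id h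
  norm_num at h1 h2 h3
  have hv := h.toValid
  by_contra hne
  have q1 := h.qne 1 le_rfl h.n_pos
  have e1 := h.ene 1
  have e2 := h.ene 2
  have l0 := h.left 2
  have c20 := col_two_zero hv hk
  have p3 := per3_e hv hk 0
  have e0 := h.ene 0
  have c01 : X.col (X.c 0) (X.c 1) = X.e 0 := rfl
  norm_num at e1 q1 e0 e2 p3
  by_cases hb : X.r i 2 = X.e 2
  · rcases eq_or_ne i 1 with rfl | hi1
    · exact h.two (i := 0) (j := 1) (a := 2) (a' := 2) (b := 0) (b' := 1) (A := [X.c 2])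
        (B := [X.c 0, X.c 1]) (by omega) hin (by omega) (.single (by grind)) (fun _ => by grind)
        (by omega) (by omega) (.cons (b := X.c 1) (by grind) (.single (by grind))) hF (perm_three hk)
    · exact h.toLosing.three (i := 0) (j := i) (a := 2) (a' := 2) (b := 0) (b' := 1) (A := [X.c 2])
        (B := [X.c 0, X.c 1]) (by omega) hin (by omega) (.single (by grind)) hB
        (by grind) (.cons (b := X.c 1) (by grind) (.single (by grind))) hF (perm_three hk)
  · exact h.one (i := i) (a := 2) (a' := 1) hin (fun _ => hB)
      (.cons (b := X.c 0) (by grind) (.cons (b := X.c 1) (by grind) (.single (by grind)))) hF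
      (perm_three hk)

theorem Special.same_left {p : ℤ} (h : X.Special p) {i : ℕ} (hi : 1 ≤ i) (hin : i ≤ X.n)
    (hB : X.r i (p + 1) ≠ X.q i) (hF : X.NonF (i + 1) (p + 1)) :
    X.r i (p + 1) = X.r (i + 1) (p + 1) := by
  have h' := h.shift p
  rw [sub_self] at h'
  have := h'.same_zero hi hin (by rw [shift_r, add_comm]; exact hB)
    (by rw [nonF_shift, add_comm 1 p]; exact hF)
  simpa [add_comm] using this

theorem Special.cross_left {p : ℤ} (h : X.Special p) {i : ℕ} (hi : 1 ≤ i) (hin : i ≤ X.n)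
    (hB : X.r i (p + 2) ≠ X.q i) (hF : X.NonF (i + 1) (p + 1)) : X.r (i + 1) (p + 1) = X.e p := by
  have h' := h.shift p
  rw [sub_self] at h'
  have := h'.cross_zero hi hin (by rw [shift_r, add_comm]; exact hB)
    (by rw [nonF_shift, add_comm 1 p]; exact hF)
  simpa [add_comm] using this

theorem Special.same_right {p : ℤ} (h : X.Special p) {i : ℕ} (hi : 1 ≤ i) (hin : i ≤ X.n)
    (hB : X.r i (p + 2) ≠ X.q i) (hF : X.NonF (i + 1) (p + 2)) :
    X.r i (p + 2) = X.r (i + 1) (p + 2) := by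
  have key : ∀ i, X.r i (-(-p + 1)) = X.r i (p + 2) := fun i => by
    rw [← per3_r h.toValid h.three]; congr 1; ring
  have := h.refl.same_left hi hin (by rw [refl_r, key]; exact hB)
    (by unfold NonF at hF ⊢; rw [refl_r, key]; exact hF)
  rwa [refl_r, refl_r, key, key] at this

theorem Special.cross_right {p : ℤ} (h : X.Special p) {i : ℕ} (hi : 1 ≤ i) (hin : i ≤ X.n)
    (hB : X.r i (p + 1) ≠ X.q i) (hF : X.NonF (i + 1) (p + 2)) :
    X.r (i + 1) (p + 2) = X.e (p + 2) := by
  have hv := h.toValid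
  have key : ∀ i, X.r i (-(-p + 1)) = X.r i (p + 2) := fun i => by
    rw [← per3_r hv h.three]; congr 1; ring
  have key' : ∀ i, X.r i (-(-p + 2)) = X.r i (p + 1) := fun i => by
    rw [← per3_r hv h.three]; congr 1; ring
  have := h.refl.cross_left hi hin (by rw [refl_r, key']; exact hB)
    (by unfold NonF at hF ⊢; rw [refl_r, key]; exact hF)
  rw [refl_r, key, refl_e hv, ← per3_e hv h.three] at this
  rw [this]; congr 1; ring

/-! The same statements, read from the other end of the path. -/

theorem cross_left_rev {p : ℤ} (h : X.rev.Special p) {i : ℕ} (hin : i + 1 ≤ X.n)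
    (hF : X.r (i + 1) (p + 2) ≠ X.q (i + 2)) (hB : 1 ≤ i → X.r i (p + 1) ≠ X.q i) :
    X.r i (p + 1) = X.e p := by
  have := h.cross_left (i := X.n - i) (by omega) (by simp) ?_ ?_
  · simpa [show X.n + 1 - (X.n - i) = i + 1 by omega, show X.n - (X.n - i) = i by omega] using this
  · simpa [show X.n + 1 - (X.n - i) = i + 1 by omega, show X.n + 2 - (X.n - i) = i + 2 by omega]
  · intro hh
    simpa [show X.n - (X.n - i) = i by omega, show X.n + 2 - (X.n - i + 1 + 1) = i by omega] using
      hB (by simp at hh; omega)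

theorem same_right_rev {p : ℤ} (h : X.rev.Special p) {i : ℕ} (hin : i + 1 ≤ X.n)
    (hF : X.r (i + 1) (p + 2) ≠ X.q (i + 2)) (hB : 1 ≤ i → X.r i (p + 2) ≠ X.q i) :
    X.r (i + 1) (p + 2) = X.r i (p + 2) := by
  have := h.same_right (i := X.n - i) (by omega) (by simp) ?_ ?_
  · simpa [show X.n + 1 - (X.n - i) = i + 1 by omega, show X.n - (X.n - i) = i by omega] using this
  · simpa [show X.n + 1 - (X.n - i) = i + 1 by omega, show X.n + 2 - (X.n - i) = i + 2 by omega]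
  · intro hh
    simpa [show X.n - (X.n - i) = i by omega, show X.n + 2 - (X.n - i + 1 + 1) = i by omega] using
      hB (by simp at hh; omega)

theorem cross_right_rev {p : ℤ} (h : X.rev.Special p) {i : ℕ} (hin : i + 1 ≤ X.n)
    (hF : X.r (i + 1) (p + 1) ≠ X.q (i + 2)) (hB : 1 ≤ i → X.r i (p + 2) ≠ X.q i) :
    X.r i (p + 2) = X.e (p + 2) := by
  have := h.cross_right (i := X.n - i) (by omega) (by simp) ?_ ?_
  · simpa [show X.n + 1 - (X.n - i) = i + 1 by omega, show X.n - (X.n - i) = i by omega] using this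
  · simpa [show X.n + 1 - (X.n - i) = i + 1 by omega, show X.n + 2 - (X.n - i) = i + 2 by omega]
  · intro hh
    simpa [show X.n - (X.n - i) = i by omega, show X.n + 2 - (X.n - i + 1 + 1) = i by omega] using
      hB (by simp at hh; omega)

/-- Along the path, no inner row has its backward color at both `p + 1` and `p + 2`: otherwise the
relations with the preceding row identify the colors of two triangle edges. But the last inner row
has this form, by speciality at the other end. -/
theorem Special.ne_of_rev {p : ℤ} (h : X.Special p) (h' : X.rev.Special p) : False := by
  have hn := h.n_pos
  have hv := h.toValid
  have ee := h.ene (p + 2)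
  rw [show p + 2 + 1 = p + 3 by ring, per3_e hv h.three] at ee
  have key : ∀ i, 1 ≤ i → i ≤ X.n → ¬ (X.r i (p + 1) = X.q i ∧ X.r i (p + 2) = X.q i) := by
    intro i hi
    induction i, hi using Nat.le_induction with
    | base =>
      rintro - ⟨ha, -⟩
      exact h.qne 1 le_rfl hn (ha.symm.trans h.r1)
    | succ i hi ih =>
      intro hin ⟨ha, hb⟩
      have ih := ih (by omega)
      have qn := h.qne (i + 1) (by omega) hin
      have a1 := h.same_left hi (by omega) (i := i)
      have a2 := h.same_right hi (by omega) (i := i)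
      have a3 := h.cross_left hi (by omega) (i := i)
      have a4 := h.cross_right hi (by omega) (i := i)
      have a5 := cross_left_rev h' hin
      have a6 := cross_right_rev h' hin
      unfold NonF at *
      grind
  refine key X.n hn le_rfl ⟨?_, ?_⟩
  · simpa using h'.r1
  · simpa using h'.r2

/-! ### Triangles with different special vertices: evolution of the rows. -/

/-- On a triangle: `c 0` is special for the start and `c 1` for the end of the path. -/
structure Opposed (X : Config V K) : Prop where
  left : X.Special 0
  right : X.rev.Special 1

theorem Opposed.colors (h : X.Opposed) : X.e 1 = X.q 1 ∧ X.e 2 = X.q (X.n + 1) ∧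
    X.e 0 ≠ X.q 1 ∧ X.e 0 ≠ X.q (X.n + 1) ∧ X.q 1 ≠ X.q (X.n + 1) := by
  have hv := h.left.toValid
  have h1 := h.left.e1
  have h2 := h.right.e1
  have e0 := h.left.ene 0
  have e1 := h.left.ene 1
  have e2 := h.left.ene 2
  have p := per3_e hv h.left.three 0
  rw [rev_q_one, rev_e] at h2
  norm_num at *
  grind

/-- Interchange the two ends of the path together with the two special vertices. -/
def mirror (X : Config V K) : Config V K := (X.rev.shift 1).refl

theorem mirror_r (i : ℕ) (j : ℤ) : X.mirror.r i j = X.r (X.n + 1 - i) (-j + 1) := rfl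
theorem mirror_q (i : ℕ) : X.mirror.q i = X.q (X.n + 2 - i) := rfl
theorem mirror_n : X.mirror.n = X.n := rfl
theorem Special.rev_rev {p : ℤ} (h : X.Special p) : X.rev.rev.Special p where
  toMinimal := h.toMinimal.rev.rev
  three := h.three
  r0 := by simpa [show X.n + 2 - (X.n + 1) = 1 by omega] using h.r0
  r1 := by simpa using h.r1
  r2 := by simpa using h.r2
  e1 := by simpa [show X.n + 2 - (X.n + 1) = 1 by omega] using h.e1

theorem Opposed.mirror (h : X.Opposed) : X.mirror.Opposed where
  left := show (X.rev.shift 1).refl.Special 0 by simpa using (h.right.shift 1).refl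
  right := show (X.rev.rev.shift 1).refl.Special 1 by simpa using (h.left.rev_rev.shift 1).refl

/-- The row `v i` looks like that of `v 1`. -/
structure RowA (X : Config V K) (i : ℕ) : Prop where
  q : X.q i = X.q 1
  r0 : X.r i 0 = X.q 1
  r1 : X.r i 1 = X.q (i + 1)
  r2 : X.r i 2 = X.q (i + 1)
  pre : X.r (i - 1) 0 = X.q 1

/-- The only edge from `v i` to the cycle not of the forward color goes to `c 1`. -/
structure RowB (X : Config V K) (i : ℕ) : Prop where
  r1 : X.r i 1 = X.e 0
  ne : X.e 0 ≠ X.q (i + 1)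
  r0 : X.r i 0 = X.q (i + 1)
  r2 : X.r i 2 = X.q (i + 1)

theorem Minimal.exists_nonF_three (h : X.Minimal) (hk : X.k = 3) {i : ℕ} (hi : 1 ≤ i)
    (hin : i ≤ X.n) : X.r i 0 ≠ X.q (i + 1) ∨ X.r i 1 ≠ X.q (i + 1) ∨ X.r i 2 ≠ X.q (i + 1) := by
  obtain ⟨d, hd⟩ := h.exists_nonF hi hin
  obtain ⟨d', hc, h0, h1⟩ := exists_rep h.toValid d 0
  rw [← hc.r h.toValid] at hd
  have : d' = 0 ∨ d' = 1 ∨ d' = 2 := by omega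
  rcases this with rfl | rfl | rfl
  · exact .inl hd
  · exact .inr (.inl hd)
  · exact .inr (.inr hd)

theorem Opposed.rowA_one (h : X.Opposed) : X.RowA 1 :=
  ⟨rfl, h.left.r0, h.left.r1, h.left.r2, h.left.left 0⟩

/-- The edge from `v (i + 1)` to `c 0` must be forward. A non-forward edge to `c 1` forces `q (i +
1) = e 0`, and one to `c 2` forces `q (i + 1) = e 2`, the right end color. -/
theorem Opposed.rowA_step (h : X.Opposed) {i : ℕ} (hi : 1 ≤ i) (hin : i + 1 ≤ X.n)
    (hA : X.RowA i) : (X.q (i + 1) = X.q (X.n + 1) ∧ X.r (i + 1) 2 = X.q (X.n + 1)) ∨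
      (X.q (i + 1) = X.e 0 ∧ X.RowB (i + 1)) := by
  have hv := h.left.toValid
  obtain ⟨c1, c2, c3, c4, c5⟩ := h.colors
  obtain ⟨a1, a2, a3, a4, a5⟩ := hA
  have q1 := h.left.qne i hi (by omega)
  have q2 := h.left.qne (i + 1) (by omega) hin
  have l1 := h.left.same_left hi (by omega) (i := i)
  have l2 := h.left.same_right hi (by omega) (i := i)
  have l3 := h.left.cross_left hi (by omega) (i := i)
  have l4 := h.left.cross_right hi (by omega) (i := i)
  have l5 := cross_left_rev h.right hin
  have p0 := per3_r hv h.left.three (i + 1) 0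
  have F := h.left.toMinimal.exists_nonF_three h.left.three (i := i + 1) (by omega) hin
  unfold NonF at *
  norm_num at *
  have s1 : X.r (i + 1) 0 = X.q (i + 2) := by grind
  by_cases ht : X.r (i + 1) 1 = X.q (i + 2)
  · left; grind
  · right
    refine ⟨by grind, ⟨by grind, by grind, by grind, by grind⟩⟩

/-- The edge to `c 2` is forward by `cross_right_rev`, and a non-forward edge to `c 0` forces `q (i
+ 1) = q 1`. If that equality holds, the detour `v i, c 0, c 2, c 1, v (i + 1)` makes the edge to `c
1` forward as well. -/
theorem Opposed.rowB_step (h : X.Opposed) {i : ℕ} (hi : 1 ≤ i) (hin : i + 1 ≤ X.n)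
    (hB : X.RowB i) : X.RowA (i + 1) ∨ X.RowB (i + 1) := by
  have hv := h.left.toValid
  obtain ⟨c1, c2, c3, c4, c5⟩ := h.colors
  obtain ⟨a1, a2, a3, a4⟩ := hB
  have q1 := h.left.qne i hi (by omega)
  have q2 := h.left.qne (i + 1) (by omega) hin
  have l1 := h.left.same_left hi (by omega) (i := i)
  have l3 := h.left.cross_left hi (by omega) (i := i)
  have l5 := cross_left_rev h.right hin
  have l6 := cross_right_rev h.right hin
  have l7 := same_right_rev h.right hin
  have p0 := per3_r hv h.left.three (i + 1) 0
  have p1 := per3_r hv h.left.three i 0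
  have p2 := per3_e hv h.left.three 0
  have p3 := per3_e hv h.left.three (-1)
  have F := h.left.toMinimal.exists_nonF_three h.left.three (i := i + 1) (by omega) hin
  have T := h.left.one_desc i (by omega) 0
  unfold NonF at *
  norm_num at *
  have w : X.r (i + 1) 2 = X.q (i + 2) := by grind
  by_cases hq : X.q (i + 1) = X.q 1
  · left
    refine ⟨hq, by grind, by grind, w, by simpa using a3.trans hq⟩
  · right
    refine ⟨by grind, by grind, by grind, w⟩

/-- Without a switch every inner row is of one of the two forms, so `v n` sees `c 2` in its forward
color; speciality at the right end makes this color backward. -/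
theorem Opposed.exists_switch (h : X.Opposed) : ∃ i, 1 ≤ i ∧ i + 1 ≤ X.n ∧ X.RowA i ∧
    X.q (i + 1) = X.q (X.n + 1) ∧ X.r (i + 1) 2 = X.q (X.n + 1) := by
  by_contra! hcon
  have hn := h.left.n_pos
  have key : ∀ i, 1 ≤ i → i ≤ X.n → X.RowA i ∨ X.RowB i := by
    intro i hi
    induction i, hi using Nat.le_induction with
    | base => exact fun _ => .inl h.rowA_one
    | succ i hi ih =>
      intro hin
      rcases ih (by omega) with hA | hB
      · rcases h.rowA_step hi hin hA with ⟨h1, h2⟩ | ⟨-, hB⟩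
        · exact absurd h2 (hcon i hi hin hA h1)
        · exact .inr hB
      · exact h.rowB_step hi hin hB
  have r2 := h.right.r1
  rw [rev_r_one, rev_q_two] at r2
  have q := h.left.qne X.n hn le_rfl
  norm_num at r2
  rcases key X.n hn le_rfl with hA | hB
  · exact q (r2.symm.trans hA.r2)
  · exact q (r2.symm.trans hB.r2)

/-! ### Hamilton paths using a chord of the path -/

theorem Opposed.q_ends (h : X.Opposed) : X.col (X.v 0) (X.v 1) = X.q 1 := (h.left.hq 0 (by omega)).symm

theorem chord_perm (hk : X.k = 3) {l : List V}
    (hl : l.Perm (seg X.v 0 (X.n + 1) ++ [X.c 0, X.c 1, X.c 2])) : l.Perm X.verts := by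
  rw [verts, hk]; exact hl

/-- The path is `v 0, c 1, c 0, c 2, v (j - 1), …, v 1, v j, …, v (n + 1)`. -/
theorem Opposed.chord_one (h : X.Opposed) {j : ℕ} (hj : 3 ≤ j) (hjn : j ≤ X.n)
    (hq : X.q (j - 1) ≠ X.q 1) (hr : X.r (j - 1) 2 = X.q 1)
    (h2 : X.col (X.v 1) (X.v j) ≠ X.q 2) (h3 : X.col (X.v 1) (X.v j) ≠ X.q (j + 1)) : False := by
  have hv := h.left.toValid
  obtain ⟨c1, c2, c3, c4, c5⟩ := h.colors
  have l1 : X.col (X.v 0) (X.c 1) = X.q 1 := h.left.left 1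
  have c20 := col_two_zero hv h.left.three
  have c01 : X.col (X.c 0) (X.c 1) = X.e 0 := rfl
  have s1 := hv.symm (X.c 0) (X.c 1)
  have s2 := hv.symm (X.c 2) (X.c 0)
  have s3 : X.col (X.c 2) (X.v (j - 1)) = X.r (j - 1) 2 := hv.symm _ _
  refine h.left.no ⟨X.v 0 :: X.c 1 :: X.c 0 :: X.c 2 :: ((seg X.v 1 (j - 1 - 1)).reverse ++
    seg X.v j (X.n + 1 - j)), chord_perm h.left.three ?_, fun ξ η hξ hη => ?_⟩
  · have e1 : seg X.v 0 (X.n + 1) = X.v 0 :: (seg X.v 1 (j - 1 - 1) ++ seg X.v j (X.n + 1 - j)) := by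
      rw [seg_succ', seg_append _ _ _ _ _ (by omega)]
      congr 2; omega
    classical
    rw [e1, List.perm_iff_count]
    intro a
    simp only [List.count_append, List.count_cons, List.count_nil, List.count_reverse]
    omega
  · have t1 := (trail_seg hv (i := 1) (j := j - 1) (α := X.col (X.v 1) (X.v j)) (β := X.q 1)
      (by omega) (by omega) (by omega) (fun _ => h2) (fun _ => hq)).reverse hv.symm
    have t2 := trail_seg hv (i := j) (j := X.n + 1) (α := X.col (X.v 1) (X.v j)) (β := η)
      (by omega) (by omega) (by omega) (fun _ => h3) (fun _ => hη.symm)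
    have t3 := t1.append t2
    rw [← hr, ← s3] at t3
    exact .cons (b := X.c 1) (l1 ▸ hξ) (.cons (b := X.c 0) (by grind [r]) (.cons (b := X.c 2) (by grind)
      (.cons (by grind) t3)))

/-- The path is `v 0, c 2, c 0, v 1, v j, …, v 2, c 1, v (j + 1), …, v (n + 1)`. -/
theorem Opposed.chord_two (h : X.Opposed) {j : ℕ} (hj : 3 ≤ j) (hjn : j ≤ X.n)
    (h1 : X.col (X.v 1) (X.v j) ≠ X.q 1) (h2 : X.col (X.v 1) (X.v j) ≠ X.q j)
    (h3 : X.r 2 1 ≠ X.q 3) (h4 : X.r 2 1 ≠ X.r (j + 1) 1)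
    (h5 : X.NonF (j + 1) 1) : False := by
  have hv := h.left.toValid
  obtain ⟨c1, c2, c3, c4, c5⟩ := h.colors
  have l1 : X.col (X.v 0) (X.c 2) = X.q 1 := h.left.left 2
  have c20 := col_two_zero hv h.left.three
  have s1 : X.col (X.c 0) (X.v 1) = X.r 1 0 := hv.symm _ _
  have s2 : X.col (X.c 1) (X.v (j + 1)) = X.r (j + 1) 1 := hv.symm _ _
  have l0 := h.left.r0
  have hr := h.left.right 1
  refine h.left.no ⟨X.v 0 :: X.c 2 :: X.c 0 :: X.v 1 :: ((seg X.v 2 (j - 2)).reverse ++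
    (X.c 1 :: seg X.v (j + 1) (X.n + 1 - (j + 1)))), chord_perm h.left.three ?_, fun ξ η hξ hη => ?_⟩
  · have e1 : seg X.v 0 (X.n + 1) = X.v 0 :: X.v 1 :: (seg X.v 2 (j - 2) ++
        seg X.v (j + 1) (X.n + 1 - (j + 1))) := by
      rw [show X.n + 1 = X.n + 1 - 2 + 1 + 1 by omega, seg_succ', seg_succ',
        seg_append _ _ _ _ _ (by omega)]
      congr 3; omega
    classical
    rw [e1, List.perm_iff_count]
    intro a
    simp only [List.count_append, List.count_cons, List.count_nil, List.count_reverse]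
    omega
  · have t1 := (trail_seg hv (i := 2) (j := j) (β := X.col (X.v 1) (X.v j)) (α := X.r 2 1)
      (by omega) (by omega) (by omega) (fun _ => h3) (fun _ => h2.symm)).reverse hv.symm
    have t2 := trail_seg hv (i := j + 1) (j := X.n + 1) (α := X.r (j + 1) 1) (β := η)
      (by omega) (by omega) (fun hh => by rw [hh, hr]; exact hη.symm) (fun hh => h5 (by omega))
      (fun _ => hη.symm)
    rw [← s2] at t2 h4
    have t3 := t1.append (.cons h4 t2)
    exact .cons (b := X.c 2) (l1 ▸ hξ) (.cons (b := X.c 0) (by grind [r]) (.cons (b := X.v 1) (by grind)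
      (.cons (by grind) t3)))

/-- The path is `v 0, v 1, v n, …, v 2, c 2, c 1, c 0, v (n + 1)`. -/
theorem Opposed.chord_three (h : X.Opposed) (hn : 3 ≤ X.n)
    (h1 : X.col (X.v 1) (X.v X.n) ≠ X.q 1) (h2 : X.col (X.v 1) (X.v X.n) ≠ X.q X.n)
    (h3 : X.r 2 2 ≠ X.q 3) (h4 : X.r 2 2 = X.q (X.n + 1)) : False := by
  have hv := h.left.toValid
  obtain ⟨c1, c2, c3, c4, c5⟩ := h.colors
  have hr := h.left.right 0
  have s1 : X.col (X.c 0) (X.v (X.n + 1)) = X.r (X.n + 1) 0 := hv.symm _ _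
  have s2 : X.col (X.c 2) (X.c 1) = X.e 1 := hv.symm _ _
  have s3 : X.col (X.c 1) (X.c 0) = X.e 0 := hv.symm _ _
  have hq := h.q_ends
  refine h.left.no ⟨X.v 0 :: X.v 1 :: ((seg X.v 2 (X.n - 2)).reverse ++
    [X.c 2, X.c 1, X.c 0, X.v (X.n + 1)]), chord_perm h.left.three ?_, fun ξ η hξ hη => ?_⟩
  · have e1 : seg X.v 0 (X.n + 1) = X.v 0 :: X.v 1 :: (seg X.v 2 (X.n - 2) ++
        seg X.v (X.n + 1) 0) := by
      rw [show X.n + 1 = X.n - 2 + 1 + 1 + 1 by omega, seg_succ', seg_succ',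
        seg_append _ _ _ _ _ (by omega)]
    classical
    rw [e1, List.perm_iff_count]
    intro a
    simp only [List.count_append, List.count_cons, List.count_nil, List.count_reverse, seg, run_zero,
      add_zero]
    omega
  · have t1 := (trail_seg hv (i := 2) (j := X.n) (β := X.col (X.v 1) (X.v X.n)) (α := X.r 2 2)
      (by omega) (by omega) (by omega) (fun _ => h3) (fun _ => h2.symm)).reverse hv.symm
    have t3 := t1.append (.cons (b := X.c 1) (by grind [r]) (.cons (b := X.c 0) (by grind)
      (.cons (b := X.v (X.n + 1)) (by grind) (.single (β := η) (by grind)))))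
    exact .cons (b := X.v 1) (hq ▸ hξ) (.cons (by grind) t3)

theorem Opposed.exists_switch_right (h : X.Opposed) : ∃ j, 3 ≤ j ∧ j ≤ X.n ∧ X.q j = X.q 1 ∧
    X.q (j + 1) = X.q (X.n + 1) ∧ X.r (j - 1) 2 = X.q 1 ∧ X.r (j + 1) 1 = X.q (X.n + 1) := by
  have hv := h.left.toValid
  obtain ⟨i, hi, hin, hA, h1, h2⟩ := h.mirror.exists_switch
  obtain ⟨a1, a2, a3, a4, a5⟩ := hA
  simp only [mirror_n, mirror_q, mirror_r] at *
  have p := per3_r hv h.left.three (X.n + 1 - (i + 1)) (-2 + 1)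
  norm_num at a2 a5 a1 h1 h2 p
  rw [show X.n + 2 - (X.n + 1) = 1 by omega] at h1 h2
  refine ⟨X.n + 1 - i, ?_, by omega, ?_, ?_, ?_, ?_⟩
  · by_contra hcon
    have hi2 : X.n + 1 - i = 2 := by omega
    have q1 := h.left.qne 1 le_rfl (by omega)
    rw [show X.n + 2 - (i + 1) = 2 by omega] at h1
    exact q1 h1.symm
  · rw [← h1]; congr 1; omega
  · rw [← a1]; congr 1; omega
  · rw [← h2, ← p]; congr 1
  · rw [← a5]; congr 1; omega

theorem Opposed.not_rowB_two (h : X.Opposed) (hq : X.q 2 = X.e 0) (hB : X.RowB 2) : False := by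
  obtain ⟨c1, c2, c3, c4, c5⟩ := h.colors
  obtain ⟨j, hj, hjn, h1, h2, h3, h4⟩ := h.exists_switch_right
  have q1 := h.left.qne (j - 1) (by omega) (by omega)
  rw [show j - 1 + 1 = j by omega] at q1
  have q2 := h.left.qne 2 (by omega) (by omega)
  have r1 := hB.r1
  by_cases hx : X.col (X.v 1) (X.v j) = X.q 1
  · exact h.chord_one hj hjn (by grind) h3 (by grind) (by grind)
  · refine h.chord_two hj hjn hx (by grind) (by grind) (by grind) (fun hh => ?_)
    have := h.left.qne (j + 1) (by omega) hh
    grind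

theorem Opposed.false (h : X.Opposed) : False := by
  have hn := h.left.two_le
  obtain ⟨c1, c2, c3, c4, c5⟩ := h.colors
  have hm := h.mirror
  rcases h.rowA_step le_rfl hn h.rowA_one with ⟨h1, h2⟩ | ⟨h1, h2⟩
  swap
  · exact h.not_rowB_two h1 h2
  rcases hm.rowA_step le_rfl hn hm.rowA_one with ⟨h3, h4⟩ | ⟨h3, h4⟩
  swap
  · exact hm.not_rowB_two h3 h4
  have p := per3_r h.left.toValid h.left.three (X.n - 1) (-2 + 1)
  simp only [mirror_n, mirror_q, mirror_r] at h3 h4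
  rw [show X.n + 2 - (X.n + 1) = 1 by omega] at h3 h4
  norm_num at h1 h2 h3 h4 p
  rw [show X.n + 1 - 2 = X.n - 1 by omega] at h4
  have hn3 : 3 ≤ X.n := by
    by_contra hcon
    have : X.n = 2 := by omega
    rw [this] at h3 h1 c5
    grind
  have q1 := h.left.qne (X.n - 1) (by omega) (by omega)
  rw [show X.n - 1 + 1 = X.n by omega] at q1
  have q2 := h.left.qne 2 (by omega) (by omega)
  -- Both switches are now extremal: `q 2 = q (n + 1)` and `q n = q 1`. Each color of the chord from
  -- `v 1` to `v n` suits one of the two constructions.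
  by_cases hx : X.col (X.v 1) (X.v X.n) = X.q (X.n + 1)
  · exact h.chord_three hn3 (by grind) (by grind) (by grind) h2
  · exact h.chord_one hn3 le_rfl (by grind) (by grind) (by grind) (by grind)

/-! ### Absence of counterexamples among configurations. -/

theorem Special.cong {p p' : ℤ} (h : X.Special p) (hp : X.Cong p' p) : X.Special p' := by
  have hv := h.toValid
  refine ⟨h.toMinimal, h.three, ?_, ?_, ?_, ?_⟩
  · rw [hp.r hv]; exact h.r0
  · rw [(cong_add.2 hp).r hv]; exact h.r1
  · rw [(cong_add.2 hp).r hv]; exact h.r2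
  · rw [hp.e hv]; exact h.e1

theorem not_minimal_of_three (hk : X.k = 3) : ¬ X.Minimal := by
  intro h
  obtain ⟨p, hp⟩ := h.exists_special hk
  obtain ⟨p', hp'⟩ := h.rev.exists_special hk
  have h1 := hp.shift p
  have h2 : (X.shift p).rev.Special (p' - p) := hp'.shift p
  rw [sub_self] at h1
  obtain ⟨d, hc, hd0, hd1⟩ := exists_rep (X := (X.shift p).rev) (h.shift p).rev.toValid (p' - p) 0
  have h3 := h2.cong hc
  have : d = 0 ∨ d = 1 ∨ d = 2 := by simp [hk] at hd1; omega
  rcases this with rfl | rfl | rfl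
  · exact h1.ne_of_rev h3
  · exact (Opposed.mk h1 h3).false
  -- Reflection turns the offset 2 into `-2`, which is 1 modulo 3.
  · refine (Opposed.mk (X := (X.shift p).refl) (by simpa using h1.refl) ?_).false
    exact (show (X.shift p).rev.refl.Special 1 from h3.refl.cong ⟨1, by simp [hk]⟩)

theorem not_losing_of_not_minimal {k : ℕ} (hm : ∀ X : Config V K, X.k = k → ¬ X.Minimal) :
    ∀ X : Config V K, X.k = k → ¬ X.Losing := by
  suffices ∀ n, ∀ X : Config V K, X.n = n → X.k = k → ¬ X.Losing from fun X => this _ X rfl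
  intro n
  induction n using Nat.strong_induction_on with
  | _ n ih =>
    intro X hn hk h
    exact hm X hk ⟨h, fun Y hY hYk => ih Y.n (by omega) Y rfl (hYk.trans hk)⟩

theorem not_losing (X : Config V K) : ¬ X.Losing := by
  intro h
  have h3 := not_losing_of_not_minimal (V := V) (K := K) (k := 3) fun _ hk => not_minimal_of_three hk
  rcases h.three_le.eq_or_lt with hk | hk
  · exact h3 X hk.symm h
  · exact not_losing_of_not_minimal (fun Y hY => not_minimal_of_four_le (by omega) h3) X rfl h

end Config

end EdgeColored

namespace EdgeColored

/-! ### Translation to walks in the complete graph. -/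

open SimpleGraph

variable {V K : Type*}

open Classical in
/-- The color of the edge between two vertices of a complete graph; the color of a loop is junk. -/
noncomputable def colorOf (c : EdgeLabeling (⊤ : SimpleGraph V) K) (x : K) (a b : V) : K :=
  if h : (⊤ : SimpleGraph V).Adj a b then c.get a b h else x

variable {c : EdgeLabeling (⊤ : SimpleGraph V) K} {x₀ : K}

theorem colorOf_of_adj {a b : V} (h : (⊤ : SimpleGraph V).Adj a b) : colorOf c x₀ a b = c.get a b h :=
  dif_pos h

theorem colorOf_symm (a b : V) : colorOf c x₀ a b = colorOf c x₀ b a := by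
  by_cases h : (⊤ : SimpleGraph V).Adj a b
  · rw [colorOf_of_adj h, colorOf_of_adj h.symm, EdgeLabeling.get_comm]
  · rw [colorOf, colorOf, dif_neg h, dif_neg fun h' => h h'.symm]

theorem IsPC.colorOf_ne {u w : V} {P : (⊤ : SimpleGraph V).Walk u w} (hP : IsPC c P.toSubgraph)
    {a v b : V} (hab : a ≠ b) (ha : P.toSubgraph.Adj a v) (hb : P.toSubgraph.Adj v b) :
    colorOf c x₀ a v ≠ colorOf c x₀ v b := by
  rw [colorOf_symm, colorOf_of_adj ha.symm.adj_sub, colorOf_of_adj hb.adj_sub]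
  exact hP ha.symm hb hab

theorem isPC_of_getVert {u w : V} {Q : (⊤ : SimpleGraph V).Walk u w} (hQ : Q.IsPath)
    (h : ∀ i, i + 2 ≤ Q.length → colorOf c x₀ (Q.getVert i) (Q.getVert (i + 1)) ≠
      colorOf c x₀ (Q.getVert (i + 1)) (Q.getVert (i + 2))) : IsPC c Q.toSubgraph := by
  have key : ∀ i v a b, i + 2 ≤ Q.length → Q.getVert i = a → Q.getVert (i + 1) = v →
      Q.getVert (i + 2) = b → ∀ (ha : (⊤ : SimpleGraph V).Adj v a) (hb : (⊤ : SimpleGraph V).Adj v b),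
      c.get v a ha ≠ c.get v b hb := by
    rintro i _ _ _ hi rfl rfl rfl ha hb
    have := h i hi
    rwa [colorOf_symm, colorOf_of_adj ha, colorOf_of_adj hb] at this
  intro v a b ha hb hab
  obtain ⟨i, hi, hil⟩ := (Walk.toSubgraph_adj_iff _).1 ha
  obtain ⟨j, hj, hjl⟩ := (Walk.toSubgraph_adj_iff _).1 hb
  have inj : ∀ i j, i ≤ Q.length → j ≤ Q.length → Q.getVert i = Q.getVert j → i = j :=
    fun i j hi hj => hQ.getVert_injOn hi hj
  rw [Sym2.eq_iff] at hi hj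
  rcases hi with ⟨hi1, hi2⟩ | ⟨hi1, hi2⟩ <;> rcases hj with ⟨hj1, hj2⟩ | ⟨hj1, hj2⟩
  · obtain rfl := inj i j hil.le hjl.le (hi1.trans hj1.symm)
    exact absurd (hi2.symm.trans hj2) hab
  · obtain rfl := inj i (j + 1) hil.le hjl (hi1.trans hj2.symm)
    exact (key j v b a hil hj1 hi1 hi2 hb.adj_sub ha.adj_sub).symm
  · obtain rfl := inj (i + 1) j hil hjl.le (hi2.trans hj1.symm)
    exact key i v a b hjl hi1 hi2 hj2 ha.adj_sub hb.adj_sub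
  · obtain rfl : i = j := by
      have := inj (i + 1) (j + 1) hil hjl (hi2.trans hj2.symm)
      omega
    exact absurd (hi1.symm.trans hj1) hab

theorem Trail.exists_walk {col : V → V → K} {α β : K} {a b : V} {l : List V}
    (h : Trail col α a l b β) (hl : l.Nodup) :
    ∃ Q : (⊤ : SimpleGraph V).Walk a b, Q.support = l := by
  induction h with
  | single h => exact ⟨.nil, rfl⟩
  | @cons α β a b z l h t ih =>
    rw [List.nodup_cons] at hl
    obtain ⟨Q, hQ⟩ := ih hl.2
    refine ⟨.cons (show (⊤ : SimpleGraph V).Adj a b from ?_) Q, by rw [Walk.support_cons, hQ]⟩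
    rw [top_adj]
    rintro rfl
    exact hl.1 (hQ ▸ Q.start_mem_support)

theorem run_getVert {u w : V} (P : (⊤ : SimpleGraph V).Walk u w) : run P.getVert P.length = P.support := by
  apply List.ext_getElem
  · simp [length_run]
  · intro i h1 h2
    simp [run, Walk.support_getElem_eq_getVert]

theorem getD_support {u w : V} (P : (⊤ : SimpleGraph V).Walk u w) {i : ℕ} (hi : i ≤ P.length) (o : V) :
    P.support.getD i o = P.getVert i := by
  rw [List.getD_eq_getElem _ _ (by rw [P.length_support]; omega), Walk.support_getElem_eq_getVert]

theorem IsPC.trail {u w : V} {P : (⊤ : SimpleGraph V).Walk u w} (hP : IsPC c P.toSubgraph)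
    (hpath : P.IsPath) {x y : K} (hnil : ¬ P.Nil)
    (hx : colorOf c x₀ u P.snd = x) (hy : colorOf c x₀ P.penultimate w = y) {ξ η : K}
    (hξ : ξ ≠ x) (hη : η ≠ y) : Trail (colorOf c x₀) ξ u P.support w η := by
  have hlen : 0 < P.length := Nat.pos_of_ne_zero fun h => hnil (Walk.length_eq_zero_iff.1 h)
  have := Trail.run (col := colorOf c x₀) (f := P.getVert) (m := P.length) (α := ξ) (β := η) ?_
    (by omega) ?_ ?_
  · simpa [run_getVert] using this
  · intro t ht
    refine hP.colorOf_ne (fun h => ?_) (P.toSubgraph_adj_getVert (by omega))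
      (P.toSubgraph_adj_getVert (by omega))
    have := hpath.getVert_injOn (show t ≤ P.length by omega) (show t + 2 ≤ P.length by omega) h
    omega
  · intro _
    rw [Walk.getVert_zero, ← hx] at *
    exact hξ
  · intro _
    rw [Walk.getVert_length]
    rw [← hy] at hη
    exact hη.symm

theorem exists_isHamiltonian_of_factor [DecidableEq V]
    (c : EdgeLabeling (⊤ : SimpleGraph V) K)
    {u₁ uₘ w : V} (P : (⊤ : SimpleGraph V).Walk u₁ uₘ) (C : (⊤ : SimpleGraph V).Walk w w)
    (hfactor : IsOnePathCycleFactor P C)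
    (hPpc : IsPC c P.toSubgraph) (hCpc : IsPC c C.toSubgraph)
    (hm : ¬ P.Nil) (x y : K)
    (hch : character c P hm = s((u₁, x), (uₘ, y)))
    (hx : colorsTo c u₁ {z | z ∈ C.support} = {x})
    (hy : colorsTo c uₘ {z | z ∈ C.support} = {y}) :
    ∃ (a b : V) (Q : (⊤ : SimpleGraph V).Walk a b) (hQ : ¬ Q.Nil),
      Q.IsHamiltonian ∧ IsPC c Q.toSubgraph ∧
        character c Q hQ = character c P hm := by
  have hlen : 0 < P.length := Nat.pos_of_ne_zero fun h => hm (Walk.length_eq_zero_iff.1 h)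
  have hne : u₁ ≠ uₘ := by
    intro h
    have := hfactor.isPath.getVert_injOn (show 0 ≤ P.length by omega) (show P.length ≤ P.length from le_rfl)
      (by simpa using h)
    omega
  have hxy : colorOf c x u₁ P.snd = x ∧ colorOf c x P.penultimate uₘ = y := by
    rw [colorOf_of_adj (P.adj_snd hm), colorOf_of_adj (P.adj_penultimate hm)]
    rw [character, Sym2.eq_iff] at hch
    rcases hch with ⟨h1, h2⟩ | ⟨h1, h2⟩
    · exact ⟨congrArg Prod.snd h1, congrArg Prod.snd h2⟩
    · exact absurd (congrArg Prod.fst h1) hne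
  have hC3 := hfactor.isCycle.three_le_length
  have hZlen : C.support.tail.length = C.length := by simp
  -- The support of the closed walk lists its base point twice; dropping the head shifts all indices
  -- by one.
  have hZ : ∀ i, i < C.length → C.support.tail.getD i u₁ = C.getVert (i + 1) := by
    intro i hi
    rw [← getD_support C (i := i + 1) hi u₁]
    simp
  have hcyc : ∀ i j : ℕ, i < C.length → j < C.length →
      C.getVert (i + 1) = C.getVert (j + 1) → i = j := by
    intro i j hi hj hij
    have := hfactor.isCycle.getVert_injOn (show 1 ≤ i + 1 ∧ i + 1 ≤ C.length by omega)
      (show 1 ≤ j + 1 ∧ j + 1 ≤ C.length by omega) hij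
    omega
  have h0 : C.getVert 0 = C.getVert C.length := by simp
  have hmemZ : ∀ z, z ∈ C.support.tail ↔ z ∈ C.support := by
    intro z
    refine ⟨List.mem_of_mem_tail, fun hz => ?_⟩
    obtain ⟨i, hi, hil⟩ := Walk.mem_support_iff_exists_getVert.1 hz
    have : ∃ j, j < C.length ∧ C.getVert (j + 1) = z := by
      rcases i with _ | i
      · exact ⟨C.length - 1, by omega, by rw [Nat.sub_add_cancel (by omega), ← h0, hi]⟩
      · exact ⟨i, hil, hi⟩
    obtain ⟨j, hj, rfl⟩ := this
    rw [← hZ j hj, List.getD_eq_getElem _ _ (by omega)]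
    exact List.getElem_mem _
  have hend : ∀ (u : V) (k : K), u ∈ P.support → colorsTo c u {z | z ∈ C.support} = {k} →
      ∀ z ∈ C.support.tail, colorOf c x u z = k := by
    intro u k hu hk z hz
    rw [hmemZ] at hz
    have hadj : (⊤ : SimpleGraph V).Adj u z := by
      rw [top_adj]; rintro rfl; exact hfactor.disjoint _ hu hz
    rw [colorOf_of_adj hadj]
    have : c.get u z hadj ∈ colorsTo c u {z | z ∈ C.support} := ⟨z, hz, hadj, rfl⟩
    rw [hk] at this
    exact this
  have hnd : (P.support ++ C.support.tail).Nodup := by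
    rw [List.nodup_append]
    refine ⟨hfactor.isPath.support_nodup, hfactor.isCycle.support_nodup, fun a ha b hb hab => ?_⟩
    subst hab
    exact hfactor.disjoint a ha ((hmemZ a).1 hb)
  have hham : HamPath (colorOf c x) (P.support ++ C.support.tail) u₁ uₘ x y := by
    refine Config.hamPath_of_lists (fun Y _ => Y.not_losing) colorOf_symm hnd
      (by rw [P.length_support]; omega) (by rw [hZlen]; exact hC3)
      (fun ξ η hξ hη => hPpc.trail hfactor.isPath hm hxy.1 hxy.2 hξ hη) ?_ ?_ ?_
      (hend _ _ P.start_mem_support hx) (hend _ _ P.end_mem_support hy)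
    · intro i hi
      rw [hZlen] at hi
      rw [hZ _ (by omega), hZ _ (by omega), hZ _ (by omega)]
      refine hCpc.colorOf_ne (fun h => ?_) (C.toSubgraph_adj_getVert (by omega))
        (C.toSubgraph_adj_getVert (by omega))
      have := hcyc _ _ (by omega) (by omega) h
      omega
    · rw [hZlen, hZ _ (by omega), hZ _ (by omega), hZ _ (by omega),
        show C.length - 2 + 1 = C.length - 1 by omega, show C.length - 1 + 1 = C.length by omega, ← h0]
      refine hCpc.colorOf_ne (fun h => ?_) ?_ (C.toSubgraph_adj_getVert (by omega))
      · rw [show C.length - 1 = C.length - 2 + 1 by omega] at h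
        have := hcyc _ _ (by omega) (by omega) h
        omega
      · have := C.toSubgraph_adj_getVert (i := C.length - 1) (by omega)
        rwa [show C.length - 1 + 1 = C.length by omega, ← h0] at this
    · rw [hZlen, hZ _ (by omega), hZ _ (by omega), hZ _ (by omega),
        show C.length - 1 + 1 = C.length by omega, ← h0]
      refine hCpc.colorOf_ne (fun h => ?_) (C.toSubgraph_adj_getVert (by omega))
        (C.toSubgraph_adj_getVert (by omega))
      rw [h0, show C.length = C.length - 1 + 1 by omega] at h
      have := hcyc _ _ (by omega) (by omega) h
      omega
  obtain ⟨L, hL, ht⟩ := hham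
  -- Two consecutive cycle edges already supply two colors, so admissible boundary colors exist.
  have hex : ∀ z : K, ∃ ξ, ξ ≠ z := by
    intro z
    have h1 := hCpc.colorOf_ne (x₀ := x) (a := C.getVert 0) (v := C.getVert (0 + 1))
      (b := C.getVert (1 + 1)) (fun h => ?_) (C.toSubgraph_adj_getVert (by omega))
        (C.toSubgraph_adj_getVert (by omega))
    · by_contra! hcon
      exact h1 ((hcon _).trans (hcon _).symm)
    · rw [h0, show C.length = C.length - 1 + 1 by omega] at h
      have := hcyc _ _ (by omega) (by omega) h
      omega
  obtain ⟨ξ, hξ⟩ := hex x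
  obtain ⟨η, hη⟩ := hex y
  have hLnd : L.Nodup := hL.nodup_iff.2 hnd
  obtain ⟨Q, hQ⟩ := (ht ξ η hξ hη).exists_walk hLnd
  have hQp : Q.IsPath := Walk.IsPath.mk' (by rw [hQ]; exact hLnd)
  have hQlen : L.length = Q.length + 1 := by rw [← hQ, Q.length_support]
  have hQ0 : ¬ Q.Nil := by
    intro h
    exact hne h.eq
  have hQpos : 0 < Q.length := Nat.pos_of_ne_zero fun h => hQ0 (Walk.length_eq_zero_iff.1 h)
  have hg : ∀ i, i ≤ Q.length → L.getD i u₁ = Q.getVert i := by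
    intro i hi
    rw [← hQ, getD_support Q hi]
  have hQx : c.get u₁ Q.snd (Q.adj_snd hQ0) = x := by
    rw [← colorOf_of_adj (x₀ := x)]
    by_contra hcon
    have := ((ht _ η hcon hη).getD u₁).2.2.2.1 (by omega)
    rw [hg 0 (by omega), hg 1 (by omega), Walk.getVert_zero] at this
    exact this rfl
  have hQy : c.get Q.penultimate uₘ (Q.adj_penultimate hQ0) = y := by
    rw [← colorOf_of_adj (x₀ := x)]
    by_contra hcon
    have := ((ht ξ _ hξ hcon).getD u₁).2.2.2.2 (by omega)
    rw [hQlen, hg _ (by omega), hg _ (by omega), Nat.add_sub_cancel, Walk.getVert_length,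
      show Q.length + 1 - 2 = Q.length - 1 by omega] at this
    exact this rfl
  refine ⟨u₁, uₘ, Q, hQ0, ?_, ?_, ?_⟩
  · rw [hQp.isHamiltonian_iff]
    intro v
    rw [hQ, hL.mem_iff, List.mem_append, hmemZ]
    exact hfactor.spanning v
  · refine isPC_of_getVert (x₀ := x) hQp fun i hi => ?_
    have := ((ht ξ η hξ hη).getD u₁).2.2.1 i (by omega)
    rwa [hg _ (by omega), hg _ (by omega), hg _ (by omega)] at this
  · rw [hch, character, hQx, hQy]

end EdgeColored

theorem theorem2 {V K : Type*} [Fintype V] [DecidableEq V]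
    (c : SimpleGraph.EdgeLabeling (⊤ : SimpleGraph V) K)
    {u₁ uₘ w : V} (P : (⊤ : SimpleGraph V).Walk u₁ uₘ) (C : (⊤ : SimpleGraph V).Walk w w)
    (hfactor : EdgeColored.IsOnePathCycleFactor P C)
    (hPpc : EdgeColored.IsPC c P.toSubgraph) (hCpc : EdgeColored.IsPC c C.toSubgraph)
    (hm : ¬ P.Nil) (x y : K)
    (hch : EdgeColored.character c P hm = s((u₁, x), (uₘ, y)))
    (hx : EdgeColored.colorsTo c u₁ {z | z ∈ C.support} = {x})
    (hy : EdgeColored.colorsTo c uₘ {z | z ∈ C.support} = {y}) :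
    ∃ (a b : V) (Q : (⊤ : SimpleGraph V).Walk a b) (hQ : ¬ Q.Nil),
      Q.IsHamiltonian ∧ EdgeColored.IsPC c Q.toSubgraph ∧
        EdgeColored.character c Q hQ = EdgeColored.character c P hm :=
  EdgeColored.exists_isHamiltonian_of_factor c P C hfactor hPpc hCpc hm x y hch hx hy
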